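/- Let $G$ be a compact semisimple Lie group with Lie algebra $\mathfrak g$, let $\mathrm{Kil}$ be the negative of its Killing form (which is positive definite), let $K$ be a closed subgroup of $G$ with Lie algebra $\mathfrak k$, let $\mathfrak m=\mathfrak k^{\perp}$ with respect to $\mathrm{Kil}$, and let $P$ be the projection of $\mathfrak g$ onto $\mathfrak m$ along $\mathfrak k$. Let $A=C^\infty_{\mathbb R}(G/K)$, viewed as the right $K$-invariant functions on $G$, and let $$\mathcal T(G/K)=\{V\in C^\infty(G,\mathfrak m): V(xs)=\mathrm{Ad}_s^{-1}V(x)\ \text{for } x\in G,\ s\in K\}$$ be the $A$-module of vector fields on $G/K$; $V$ acts on $A$ by $(\delta_Vf)(x)=\frac{d}{dt}\big|_{0}f(x\exp(tV(x)))$, and $G$ acts on $\mathcal T(G/K)$ by translation. The canonical connection is $(\nabla^c_VW)(x)=\frac{d}{dt}\big|_{0}W(x\exp(tV(x)))$. For $X\in\mathfrak g$ let $\hat X\in\mathcal T(G/K)$ be $\hat X(x)=-P\,\mathrm{Ad}_x^{-1}X$. Let $(G/K,g_0,J)$ be almost Hermitian: $g_0$ is an inner product on $\mathfrak m$ and $J$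 is a complex structure on $\mathfrak m$ orthogonal for $g_0$, both invariant under $\mathrm{Ad}(K)$. Let $S$ be the operator on $\mathfrak m$ with $g_0(X,Y)=\mathrm{Kil}(SX,Y)$, and $S^{1/2}$ its $\mathrm{Kil}$-positive square root. Let $\mathfrak m_J$ be $\mathfrak m$ as a complex vector space with $iX=JX$ and inner product $\langle X,Y\rangle_J=g_0(X,Y)+ig_0(JX,Y)$, linear in $Y$. Let $\mathcal S=\bigwedge^*\mathfrak m_J$, with inner product $\langle X_1\wedge\dots\wedge X_p,\,Y_1\wedge\dots\wedge Y_q\rangle=\delta_{pq}\det[\langle X_k,Y_l\rangle_J]$ and the Clifford action $\kappa(X)=i(a(X)+a^\dagger(X))$, where $a^\dagger(X)\psi=X\wedge\psi$ and $a(X)(X_1\wedge\dots\wedge X_p)=\sum_j(-1)^{j-1}\langle X,X_j\rangle_J\,X_1\wedge\dots\wedge\widehat{X_j}\wedge\dots\wedge X_p$. Let $\chi$ be a (continuous, unitary) character of $K$ and $$\mathcal S(G/K,\chi)=\{\psi\in C^\infty(G,\mathcal S):\psi(xs)=\bar\chi(s)\,\mathrm{Ad}_s^{-1}(\psi(x))\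 \text{for } x\in G,\ s\in K\},$$ where $K$ acts on $\mathcal S$ by exterior-algebra automorphisms extending $\mathrm{Ad}$. Let $\nabla$ be a $G$-invariant connection on $\mathcal T(G/K)$ that is compatible with $g_0$ and commutes with $J$, and let $L=\nabla-\nabla^c$. Each $L_V$ is an $A$-module endomorphism, given by $(L_VW)(x)=L_V(x)(W(x))$ with $L_V(x)\in\mathrm{End}(\mathfrak m)$ commuting with $J$; let $L^{\mathcal S}_V(x)$ be its extension to a derivation of $\mathcal S$. Put $(\nabla^{\mathcal S}_V\psi)(x)=\frac{d}{dt}\big|_0\psi(x\exp(tV(x)))+L^{\mathcal S}_V(x)\psi(x)$. The Dirac operator is $D^\nabla\psi=\kappa(\mathrm{grad}\,\psi)$, where $\mathrm{grad}\,\psi$ corresponds to $V\mapsto\nabla^{\mathcal S}_V\psi$ under the identification of $\mathfrak m$ with its dual by $g_0$. It is formally self-adjoint if $\int_G\langle D^\nabla\psi,\varphi\rangle=\int_G\langle\psi,D^\nabla\varphi\rangle$ (Haar measure) for all $\psi,\varphi\in\mathcal S(G/K,\chi)$. A standard module frame is a finite family $\{W_j\}$ in $\mathcal T(G/K)$ with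 $V=\sum_jW_j\,g_0(W_j,V)$ for all $V\in\mathcal T(G/K)$. Then: 1. $D^\nabla$ is formally self-adjoint if and only if $\sum_jL_{W_j}W_j=0$ for every standard module frame $\{W_j\}$, and also if and only if $\sum_jL_{W_j}W_j=0$ for some standard module frame. 2. There is an $\mathrm{Ad}(K)$-invariant $Z\in\mathfrak m$ such that, for every standard module frame $\{W_j\}$, $\sum_jL_{W_j}W_j$ is the constant function $Z$ on $G$. 3. $D^\nabla$ is formally self-adjoint if and only if $\sum_pL_{\hat X_p}(e)(S^{-1/2}Y_p)=0$, where $X_p=S^{1/2}Y_p$, for every $g_0$-orthonormal basis $\{Y_p\}$ of $\mathfrak m$, and also if and only if this holds for some such basis. -/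

import Mathlib

open scoped Manifold ContDiff


noncomputable section

namespace HomDirac

section Spinors

/-- A real vector space with an inner product `g` and a complex structure `J` orthogonal for `g`. -/
structure HermSpace (M : Type*) [AddCommGroup M] [Module ℝ M] where
  /-- the inner product -/
  g : LinearMap.BilinForm ℝ M
  symm : ∀ X Y, g X Y = g Y X
  pos : ∀ X, X ≠ 0 → 0 < g X X
  /-- the complex structure -/
  J : M →ₗ[ℝ] M
  J_sq : ∀ X, J (J X) = -X
  J_orth : ∀ X Y, g (J X) (J Y) = g X Y

namespace HermSpace

variable {M : Type*} [AddCommGroup M] [Module ℝ M] (h : HermSpace M)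

/-- `M` viewed as a complex vector space `M_J`, with `i X = J X`. -/
def MJ (_ : HermSpace M) : Type _ := M

instance : AddCommGroup h.MJ := inferInstanceAs (AddCommGroup M)

/-- The identity map from `M` to `M_J`. -/
def toMJ : M ≃+ h.MJ := AddEquiv.refl M

instance : SMul ℂ h.MJ where
  smul z X := h.toMJ (z.re • h.toMJ.symm X + z.im • h.J (h.toMJ.symm X))

theorem smul_def (z : ℂ) (X : h.MJ) :
    z • X = h.toMJ (z.re • h.toMJ.symm X + z.im • h.J (h.toMJ.symm X)) := rfl

instance : Module ℂ h.MJ where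
  one_smul X := by simp [smul_def]
  mul_smul z w X := by
    simp only [smul_def, AddEquiv.symm_apply_apply]
    refine congrArg h.toMJ ?_
    simp only [map_add, map_smul, J_sq, Complex.mul_re, Complex.mul_im]
    module
  smul_zero z := by simp [smul_def]
  smul_add z X Y := by
    simp only [smul_def, ← map_add]
    congr 1
    simp only [map_add]
    module
  add_smul z w X := by
    simp only [smul_def, ← map_add]
    congr 1
    simp only [Complex.add_re, Complex.add_im]
    module
  zero_smul X := by simp [smul_def]

instance [Module.Finite ℝ M] : Module.Finite ℂ h.MJ := by
  obtain ⟨s, hs⟩ := (inferInstance : Module.Finite ℝ M).fg_top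
  classical
  refine ⟨⟨s.image h.toMJ, ?_⟩⟩
  rw [eq_top_iff]
  rintro X -
  have hX : h.toMJ.symm X ∈ Submodule.span ℝ (s : Set M) := hs ▸ Submodule.mem_top
  have : ∀ Y ∈ Submodule.span ℝ (s : Set M),
      h.toMJ Y ∈ Submodule.span ℂ ((s.image h.toMJ : Finset h.MJ) : Set h.MJ) := by
    intro Y hY
    induction hY using Submodule.span_induction with
    | mem Y hY => exact Submodule.subset_span (by
      rw [Finset.coe_image]; exact ⟨Y, hY, rfl⟩)
    | zero => simp
    | add a b _ _ ha hb => rw [map_add]; exact add_mem ha hb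
    | smul c a _ ha =>
      have : h.toMJ (c • a) = (c : ℂ) • h.toMJ a := by
        rw [smul_def]; simp
      rw [this]
      exact Submodule.smul_mem _ _ ha
  simpa using this _ hX

/-- A real-linear endomorphism of `M` which commutes with `J`, as a complex-linear endomorphism
of `M_J`. -/
def complexify (l : M →ₗ[ℝ] M) (hl : ∀ X, l (h.J X) = h.J (l X)) : h.MJ →ₗ[ℂ] h.MJ where
  toFun X := h.toMJ (l (h.toMJ.symm X))
  map_add' X Y := by simp
  map_smul' z X := by simp [smul_def, hl]

/-- The complex inner product `⟨X, Y⟩_J = g (X, Y) + i g (J X, Y)` on `M_J`, linear in the second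
variable, as a linear functional of `Y`. -/
def herm (X : M) : Module.Dual ℂ h.MJ where
  toFun Y := h.g X (h.toMJ.symm Y) + Complex.I * h.g (h.J X) (h.toMJ.symm Y)
  map_add' Y Z := by simp; ring
  map_smul' z Y := by
    have h1 : ∀ Y, h.g X (h.J Y) = -h.g (h.J X) Y := fun Y => by
      rw [← h.J_orth X, h.J_sq, map_neg]
    apply Complex.ext <;> simp [smul_def, h1, h.J_orth] <;> ring

/-- The space of spinors: the complex exterior algebra of `M_J`. -/
abbrev Spinor : Type _ := ExteriorAlgebra ℂ h.MJ

instance [Module.Finite ℝ M] : Module.Finite ℂ h.Spinor :=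
  Module.Finite.of_basis (Module.finBasis ℂ h.MJ).ExteriorAlgebra

/-- The annihilation operator
`a(X) (X₁ ∧ … ∧ Xₚ) = ∑ⱼ (-1)ʲ⁻¹ ⟨X, Xⱼ⟩_J X₁ ∧ … ∧ X̂ⱼ ∧ … ∧ Xₚ`. -/
def annihilation (X : M) : h.Spinor →ₗ[ℂ] h.Spinor :=
  CliffordAlgebra.contractLeft (Q := (0 : QuadraticForm ℂ h.MJ)) (h.herm X)

/-- The creation operator `a†(X) (X₁ ∧ … ∧ Xₚ) = X ∧ X₁ ∧ … ∧ Xₚ`. -/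
def creation (X : M) : h.Spinor →ₗ[ℂ] h.Spinor :=
  LinearMap.mulLeft ℂ (ExteriorAlgebra.ι ℂ (h.toMJ X))

/-- The action `κ (X) = i (a(X) + a†(X))` of vectors on spinors. -/
def clifford (X : M) : h.Spinor →ₗ[ℂ] h.Spinor :=
  Complex.I • (h.annihilation X + h.creation X)

theorem herm_add (X Y : M) : h.herm (X + Y) = h.herm X + h.herm Y := by
  ext Z; simp [herm]; ring

theorem herm_smul (z : ℂ) (X : h.MJ) :
    h.herm (h.toMJ.symm (z • X)) = (starRingEnd ℂ z) • h.herm (h.toMJ.symm X) := by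
  ext Z
  apply Complex.ext <;> simp [herm, smul_def, h.J_sq]

theorem herm_symm (X Y : M) :
    starRingEnd ℂ (h.herm X (h.toMJ Y)) = h.herm Y (h.toMJ X) := by
  have h1 : h.g (h.J Y) X = -h.g (h.J X) Y := by
    rw [← h.J_orth, h.J_sq, map_neg, LinearMap.neg_apply, h.symm]
  apply Complex.ext
  · simp [herm, h.symm X Y]
  · simp [herm, h1]

/-- The step of the recursion which defines the inner product of spinors: a conjugate-linear
functional `θ` is sent to `ψ ↦ θ (a(Y) ψ)`. -/
def innerStep : h.MJ →ₗ[ℂ] (h.Spinor →ₛₗ[starRingEnd ℂ] ℂ) →ₗ[ℂ]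
    (h.Spinor →ₛₗ[starRingEnd ℂ] ℂ) :=
  LinearMap.mk₂ ℂ (fun Y θ => θ.comp (h.annihilation (h.toMJ.symm Y)))
    (fun Y Z θ => by ext ψ; simp [annihilation, herm_add])
    (fun z Y θ => by ext ψ; simp [annihilation, herm_smul])
    (fun Y θ η => by ext ψ; simp)
    (fun z Y θ => by ext ψ; simp)

theorem innerStep_innerStep (Y : h.MJ) (θ : h.Spinor →ₛₗ[starRingEnd ℂ] ℂ) :
    h.innerStep Y (h.innerStep Y θ) = (0 : QuadraticForm ℂ h.MJ) Y • θ := by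
  ext ψ
  simp [innerStep, annihilation, CliffordAlgebra.contractLeft_contractLeft]

/-- The conjugate of the scalar component of a spinor. -/
def innerBase : h.Spinor →ₛₗ[starRingEnd ℂ] ℂ where
  toFun ψ := starRingEnd ℂ (ExteriorAlgebra.algebraMapInv ψ)
  map_add' ψ φ := by simp
  map_smul' z ψ := by simp

/-- The inner product of spinors, conjugate-linear in the first and linear in the second variable,
determined by `⟨ψ, 1⟩ = conj ψ₀` (`ψ₀` the scalar component of `ψ`) and
`⟨ψ, Y ∧ φ⟩ = ⟨a(Y) ψ, φ⟩`. The next two theorems show that this is the inner product with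
`⟨X₁ ∧ … ∧ Xₚ, Y₁ ∧ … ∧ Y_q⟩ = δ_{pq} det [⟨X_k, Y_l⟩_J]`. -/
def spinInner (ψ φ : h.Spinor) : ℂ :=
  CliffordAlgebra.foldr (0 : QuadraticForm ℂ h.MJ) h.innerStep h.innerStep_innerStep h.innerBase φ ψ

theorem spinInner_one (ψ : h.Spinor) :
    h.spinInner ψ 1 = starRingEnd ℂ (ExteriorAlgebra.algebraMapInv ψ) := by
  simp [spinInner]; rfl

theorem spinInner_ι_mul (ψ φ : h.Spinor) (Y : M) :
    h.spinInner ψ (ExteriorAlgebra.ι ℂ (h.toMJ Y) * φ) = h.spinInner (h.annihilation Y ψ) φ := by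
  simp only [spinInner]
  erw [CliffordAlgebra.foldr_mul, CliffordAlgebra.foldr_ι]
  rfl

theorem spinInner_sum {α : Type*} (s : Finset α) (c : α → ℂ) (ψ : α → h.Spinor) (φ : h.Spinor) :
    h.spinInner (∑ i ∈ s, c i • ψ i) φ = ∑ i ∈ s, starRingEnd ℂ (c i) * h.spinInner (ψ i) φ := by
  simp [spinInner, map_sum]

theorem annihilation_ιMulti (X : M) : ∀ {p : ℕ} (Z : Fin (p + 1) → h.MJ),
    h.annihilation X (ExteriorAlgebra.ιMulti ℂ (p + 1) Z) =
      ∑ j : Fin (p + 1), ((-1) ^ (j : ℕ) * h.herm X (Z j)) •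
        ExteriorAlgebra.ιMulti ℂ p (Z ∘ j.succAbove) := by
  intro p
  induction p with
  | zero =>
    intro Z
    simp [annihilation, CliffordAlgebra.contractLeft_ι, Algebra.algebraMap_eq_smul_one]
  | succ p ih =>
    intro Z
    have h1 : h.annihilation X (ExteriorAlgebra.ι ℂ (Z 0) *
        ExteriorAlgebra.ιMulti ℂ (p + 1) (Matrix.vecTail Z)) =
        h.herm X (Z 0) • ExteriorAlgebra.ιMulti ℂ (p + 1) (Matrix.vecTail Z) -
        ExteriorAlgebra.ι ℂ (Z 0) *
          h.annihilation X (ExteriorAlgebra.ιMulti ℂ (p + 1) (Matrix.vecTail Z)) :=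
      CliffordAlgebra.contractLeft_ι_mul ..
    rw [ExteriorAlgebra.ιMulti_succ_apply, h1, ih, Finset.mul_sum, Fin.sum_univ_succ (n := p + 1), sub_eq_add_neg,
      ← Finset.sum_neg_distrib]
    congr 1
    · simp [Fin.succAbove_zero]; rfl
    · refine Finset.sum_congr rfl fun j _ => ?_
      rw [ExteriorAlgebra.ιMulti_succ_apply (v := Z ∘ j.succ.succAbove), mul_smul_comm, ← neg_smul]
      have e1 : (Z ∘ j.succ.succAbove) 0 = Z 0 := by simp
      have e2 : Matrix.vecTail (Z ∘ j.succ.succAbove) = Matrix.vecTail Z ∘ j.succAbove := by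
        funext k; simp [Matrix.vecTail]
      rw [e1, e2]
      congr 1
      simp [Matrix.vecTail, pow_succ]

theorem spinInner_ιMulti : ∀ {p : ℕ} (X Y : Fin p → h.MJ),
    h.spinInner (ExteriorAlgebra.ιMulti ℂ p X) (ExteriorAlgebra.ιMulti ℂ p Y) =
      (Matrix.of fun k l => h.herm (h.toMJ.symm (X k)) (Y l)).det := by
  intro p
  induction p with
  | zero => intro X Y; simp [spinInner_one]
  | succ p ih =>
    intro X Y
    rw [ExteriorAlgebra.ιMulti_succ_apply (v := Y), Matrix.det_succ_column_zero]
    have := h.spinInner_ι_mul (ExteriorAlgebra.ιMulti ℂ (p + 1) X)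
      (ExteriorAlgebra.ιMulti ℂ p (Matrix.vecTail Y)) (h.toMJ.symm (Y 0))
    rw [AddEquiv.apply_symm_apply] at this
    rw [this, annihilation_ιMulti, spinInner_sum]
    refine Finset.sum_congr rfl fun j _ => ?_
    have hj : starRingEnd ℂ (h.herm (h.toMJ.symm (Y 0)) (X j)) =
        h.herm (h.toMJ.symm (X j)) (Y 0) :=
      h.herm_symm (h.toMJ.symm (Y 0)) (h.toMJ.symm (X j))
    rw [ih, map_mul, hj, map_pow, map_neg, map_one]
    rfl

theorem spinInner_ιMulti_of_ne : ∀ {q p : ℕ} (_ : p ≠ q) (X : Fin p → h.MJ) (Y : Fin q → h.MJ),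
    h.spinInner (ExteriorAlgebra.ιMulti ℂ p X) (ExteriorAlgebra.ιMulti ℂ q Y) = 0 := by
  intro q
  induction q with
  | zero =>
    intro p hp X Y
    obtain ⟨p, rfl⟩ := Nat.exists_eq_succ_of_ne_zero hp
    rw [ExteriorAlgebra.ιMulti_zero_apply, spinInner_one, ExteriorAlgebra.ιMulti_succ_apply, map_mul]
    simp [ExteriorAlgebra.algebraMapInv]
  | succ q ih =>
    intro p hp X Y
    have := h.spinInner_ι_mul (ExteriorAlgebra.ιMulti ℂ p X)
      (ExteriorAlgebra.ιMulti ℂ q (Matrix.vecTail Y)) (h.toMJ.symm (Y 0))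
    rw [AddEquiv.apply_symm_apply] at this
    rw [ExteriorAlgebra.ιMulti_succ_apply, this]
    cases p with
    | zero =>
      have h0 : h.annihilation (h.toMJ.symm (Y 0)) (ExteriorAlgebra.ιMulti ℂ 0 X) = 0 := by
        rw [ExteriorAlgebra.ιMulti_zero_apply]
        exact CliffordAlgebra.contractLeft_one (Q := (0 : QuadraticForm ℂ h.MJ)) _
      rw [h0]
      simp [spinInner]
    | succ p =>
      rw [annihilation_ιMulti, spinInner_sum]
      refine Finset.sum_eq_zero fun j _ => ?_
      rw [ih (by omega), mul_zero]

section Derivation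

variable [Module.Finite ℝ M]

/-- The extension of a complex-linear endomorphism `l` of `M_J` to a derivation of the exterior
algebra: `X₁ ∧ … ∧ Xₚ ↦ ∑ⱼ X₁ ∧ … ∧ l (Xⱼ) ∧ … ∧ Xₚ`. It is written as `∑ᵢ a†(l bᵢ) ∘ bᵢ*` for
a basis `b`; the next two theorems are the derivation property on generators. -/
def extDer (l : h.MJ →ₗ[ℂ] h.MJ) : h.Spinor →ₗ[ℂ] h.Spinor :=
  ∑ i, LinearMap.mulLeft ℂ (ExteriorAlgebra.ι ℂ (l (Module.finBasis ℂ h.MJ i))) ∘ₗ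
    CliffordAlgebra.contractLeft (Q := (0 : QuadraticForm ℂ h.MJ))
      ((Module.finBasis ℂ h.MJ).coord i)

theorem extDer_one (l : h.MJ →ₗ[ℂ] h.MJ) : h.extDer l 1 = 0 := by
  simp [extDer, CliffordAlgebra.contractLeft_one]

theorem extDer_ι_mul (l : h.MJ →ₗ[ℂ] h.MJ) (X : h.MJ) (ψ : h.Spinor) :
    h.extDer l (ExteriorAlgebra.ι ℂ X * ψ) =
      ExteriorAlgebra.ι ℂ (l X) * ψ + ExteriorAlgebra.ι ℂ X * h.extDer l ψ := by
  set b := Module.finBasis ℂ h.MJ with hb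
  have hX : l X = ∑ i, b.coord i X • l (b i) := by
    conv_lhs => rw [← b.sum_repr X, map_sum]
    simp only [map_smul, Module.Basis.coord_apply]
  have key : ∀ i, CliffordAlgebra.contractLeft (Q := (0 : QuadraticForm ℂ h.MJ)) (b.coord i)
      (ExteriorAlgebra.ι ℂ X * ψ) = b.coord i X • ψ - ExteriorAlgebra.ι ℂ X *
        CliffordAlgebra.contractLeft (Q := (0 : QuadraticForm ℂ h.MJ)) (b.coord i) ψ := fun i =>
    CliffordAlgebra.contractLeft_ι_mul ..
  have anti : ∀ (Y Z : h.MJ) (φ : h.Spinor), ExteriorAlgebra.ι ℂ Y * (ExteriorAlgebra.ι ℂ Z * φ) =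
      -(ExteriorAlgebra.ι ℂ Z * (ExteriorAlgebra.ι ℂ Y * φ)) := by
    intro Y Z φ
    rw [eq_neg_iff_add_eq_zero, ← mul_assoc, ← mul_assoc, ← add_mul,
      ExteriorAlgebra.ι_add_mul_swap (R := ℂ) Y Z, zero_mul]
  simp only [extDer, LinearMap.sum_apply, LinearMap.comp_apply, LinearMap.mulLeft_apply, ← hb]
  rw [hX, map_sum, Finset.sum_mul, Finset.mul_sum, ← Finset.sum_add_distrib]
  refine Finset.sum_congr rfl fun i _ => ?_
  rw [key, mul_sub, anti, sub_neg_eq_add, map_smul, mul_smul_comm, smul_mul_assoc]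

end Derivation

end HermSpace

end Spinors
section Group

variable {E : Type*} [NormedAddCommGroup E] [NormedSpace ℝ E] [FiniteDimensional ℝ E]
  {H : Type*} [TopologicalSpace H] (I : ModelWithCorners ℝ E H)
  {G : Type*} [TopologicalSpace G] [ChartedSpace H G] [Group G]

instance lieGroupMinSmoothness [LieGroup I ∞ G] : LieGroup I (minSmoothness ℝ 3) G := by
  rw [minSmoothness_of_isRCLikeNormedField]
  infer_instance

instance finiteDimensionalLieAlg : FiniteDimensional ℝ (GroupLieAlgebra I G) :=
  inferInstanceAs (FiniteDimensional ℝ E)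

/-- Conjugation `z ↦ x z x⁻¹`. -/
def conj (x : G) (z : G) : G := x * z * x⁻¹

/-- The derivative at the identity of conjugation by `x`, on the model space `E` which underlies the
Lie algebra of `G`. -/
def AdL (x : G) : E →L[ℝ] E := mfderiv I I (conj x) (1 : G)

/-- The adjoint action: `Ad x` is the derivative at the identity of conjugation by `x`. -/
def Ad (x : G) : GroupLieAlgebra I G →ₗ[ℝ] GroupLieAlgebra I G := (AdL I x).toLinearMap

variable [LieGroup I ∞ G]

theorem conj_one (x : G) : conj x 1 = 1 := by simp [conj]

theorem contMDiff_conj (x : G) : ContMDiff I I ∞ (conj x) := by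
  exact (contMDiff_const.mul contMDiff_id).mul contMDiff_const

theorem mdiff_conj (x z : G) : MDifferentiableAt I I (conj x) z :=
  (contMDiff_conj I x).mdifferentiableAt (by simp)

theorem Ad_one : Ad I (1 : G) = LinearMap.id := by
  have : conj (1 : G) = id := by ext z; simp [conj]
  unfold Ad AdL
  rw [this, mfderiv_id]
  rfl

theorem mfderiv_conj_congr (x z : G) (hz : z = 1) (v : E) :
    (show E →L[ℝ] E from mfderiv I I (conj x) z) v =
      AdL I x v := by
  subst hz; rfl

theorem Ad_mul (x y : G) (v : GroupLieAlgebra I G) : Ad I (x * y) v = Ad I x (Ad I y v) := by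
  have h : conj (x * y) = conj x ∘ conj y := by ext z; simp [conj, mul_assoc]
  have := mfderiv_comp (I := I) (I' := I) (I'' := I) (1 : G) (mdiff_conj I x (conj y 1))
    (mdiff_conj I y 1)
  rw [← h] at this
  have h2 := DFunLike.congr_fun this v
  exact h2.trans (mfderiv_conj_congr I x (conj y 1) (conj_one y) _)

theorem Ad_inv_apply (x : G) (v : GroupLieAlgebra I G) : Ad I x⁻¹ (Ad I x v) = v := by
  rw [← Ad_mul, inv_mul_cancel, Ad_one]; rfl

theorem Ad_apply_inv (x : G) (v : GroupLieAlgebra I G) : Ad I x (Ad I x⁻¹ v) = v := by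
  rw [← Ad_mul, mul_inv_cancel, Ad_one]; rfl

theorem isInvertible_mfderiv_conj (x h : G) : (mfderiv I I (conj x) h).IsInvertible := by
  have hc : conj x⁻¹ ∘ conj x = (id : G → G) := by ext z; simp [conj, mul_assoc]
  have hc' : conj x ∘ conj x⁻¹ = (id : G → G) := by ext z; simp [conj, mul_assoc]
  have e1 := mfderiv_comp (I := I) (I' := I) (I'' := I) h (mdiff_conj I x⁻¹ (conj x h))
    (mdiff_conj I x h)
  rw [hc, mfderiv_id] at e1
  have e2 := mfderiv_comp (I := I) (I' := I) (I'' := I) (conj x h)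
    (mdiff_conj I x (conj x⁻¹ (conj x h))) (mdiff_conj I x⁻¹ (conj x h))
  rw [hc', mfderiv_id] at e2
  have hh : conj x⁻¹ (conj x h) = h := congrFun hc h
  rw [hh] at e2
  exact ContinuousLinearMap.IsInvertible.of_inverse e2.symm e1.symm

theorem mpullback_conj (x : G) (v : GroupLieAlgebra I G) :
    VectorField.mpullback I I (conj x) (mulInvariantVectorField (Ad I x v)) =
      mulInvariantVectorField v := by
  ext h
  have key : (mulInvariantVectorField (Ad I x v) : ∀ g : G, TangentSpace I g) (conj x h) =
      mfderiv I I (conj x) h (mulInvariantVectorField v h) := by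
    have hL : ∀ g z : G, MDifferentiableAt I I (g * ·) z := fun g z =>
      ((contMDiff_mul_left (I := I) (n := ∞) (a := g)).mdifferentiableAt (by simp))
    have hc : (conj x h * ·) ∘ conj x = conj x ∘ (h * ·) := by
      ext z; simp [conj, mul_assoc]
    have e1 := mfderiv_comp (I := I) (I' := I) (I'' := I) (1 : G) (hL (conj x h) (conj x 1))
      (mdiff_conj I x 1)
    have e2 := mfderiv_comp (I := I) (I' := I) (I'' := I) (1 : G) (mdiff_conj I x (h * 1))
      (hL h 1)
    have aux1 : ∀ (z : G) (_ : z = 1) (w : E),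
        (show E →L[ℝ] E from mfderiv I I (conj x h * ·) z) w =
        (show E →L[ℝ] E from mfderiv I I (conj x h * ·) (1 : G)) w := by
      rintro z rfl w; rfl
    have aux2 : ∀ (z : G) (_ : z = h) (w : E),
        (show E →L[ℝ] E from mfderiv I I (conj x) z) w =
        (show E →L[ℝ] E from mfderiv I I (conj x) h) w := by
      rintro z rfl w; rfl
    rw [hc] at e1
    have e3 := (DFunLike.congr_fun e1 v).symm.trans (DFunLike.congr_fun e2 v)
    exact (aux1 _ (conj_one x) _).symm.trans (e3.trans (aux2 _ (mul_one h) _))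
  rw [VectorField.mpullback_apply, key]
  exact (isInvertible_mfderiv_conj I x h).inverse_apply_eq.2 rfl

theorem Ad_lie (x : G) (v w : GroupLieAlgebra I G) : Ad I x ⁅v, w⁆ = ⁅Ad I x v, Ad I x w⁆ := by
  have h := VectorField.mpullback_mlieBracket (I := I) (I' := I) (n := minSmoothness ℝ 3) (f := conj x) (x₀ := (1 : G))
    (mdifferentiableAt_mulInvariantVectorField (I := I) (Ad I x v) (g := conj x 1))
    (mdifferentiableAt_mulInvariantVectorField (I := I) (Ad I x w) (g := conj x 1))
    (by
      rw [minSmoothness_of_isRCLikeNormedField]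
      exact (contMDiff_conj I x).contMDiffAt.of_le ENat.LEInfty.out)
    (minSmoothness_monotone (by norm_cast))
  rw [mpullback_conj, mpullback_conj, VectorField.mpullback_apply,
    (isInvertible_mfderiv_conj I x 1).inverse_apply_eq] at h
  have aux : ∀ (z : G) (_ : z = 1),
      (VectorField.mlieBracket I (mulInvariantVectorField (Ad I x v))
        (mulInvariantVectorField (Ad I x w)) z : E) =
      (VectorField.mlieBracket I (mulInvariantVectorField (Ad I x v))
        (mulInvariantVectorField (Ad I x w)) (1 : G) : E) := by
    rintro z rfl; rfl
  exact h.symm.trans (aux _ (conj_one x))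

/-- The adjoint action as a Lie algebra automorphism. -/
def AdEquiv (x : G) : GroupLieAlgebra I G ≃ₗ⁅ℝ⁆ GroupLieAlgebra I G :=
  { Ad I x with
    map_lie' := fun {v w} => Ad_lie I x v w
    invFun := Ad I x⁻¹
    left_inv := Ad_inv_apply I x
    right_inv := Ad_apply_inv I x }

variable (G) in
/-- `Kil`, the negative of the Killing form of the Lie algebra of `G`. -/
def Kil : LinearMap.BilinForm ℝ (GroupLieAlgebra I G) := -killingForm ℝ (GroupLieAlgebra I G)

theorem Kil_Ad (x : G) (v w : GroupLieAlgebra I G) :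
    Kil I G (Ad I x v) (Ad I x w) = Kil I G v w := by
  have := LieAlgebra.killingForm_of_equiv_apply (R := ℝ) (AdEquiv I x) v w
  simp only [Kil, LinearMap.neg_apply]
  exact congrArg Neg.neg this

theorem Kil_Ad_left (x : G) (v w : GroupLieAlgebra I G) :
    Kil I G v (Ad I x w) = Kil I G (Ad I x⁻¹ v) w := by
  rw [← Kil_Ad I x⁻¹ v, Ad_inv_apply]

/-- `γ` is the one-parameter subgroup `t ↦ exp (t X)` of `G`. -/
def IsOneParameterSubgroup (γ : ℝ → G) (X : GroupLieAlgebra I G) : Prop :=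
  γ 0 = 1 ∧ (∀ s t, γ (s + t) = γ s * γ t) ∧
    HasMFDerivAt 𝓘(ℝ, ℝ) I γ 0 (ContinuousLinearMap.toSpanSingleton ℝ (X : E))

variable (K : Subgroup G)

/-- The Lie algebra of the closed subgroup `K`: the tangent vectors `X` with `exp (t X) ∈ K` for all
`t`. (For closed `K` this set of vectors is already a subspace.) -/
def lieK : Submodule ℝ (GroupLieAlgebra I G) :=
  Submodule.span ℝ {X | ∃ γ : ℝ → G, IsOneParameterSubgroup I γ X ∧ ∀ t, γ t ∈ K}

/-- `𝔪`, the orthogonal complement of the Lie algebra of `K` with respect to `Kil`. -/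
def mm : Submodule ℝ (GroupLieAlgebra I G) where
  carrier := {Y | ∀ X ∈ lieK I K, Kil I G X Y = 0}
  add_mem' := fun {a b} ha hb X hX => by rw [map_add, ha X hX, hb X hX, add_zero]
  zero_mem' := fun X _ => map_zero _
  smul_mem' := fun c a ha X hX => by rw [map_smul, ha X hX, smul_zero]

theorem Ad_mem_lieK {s : G} (hs : s ∈ K) {X : GroupLieAlgebra I G} (hX : X ∈ lieK I K) :
    Ad I s X ∈ lieK I K := by
  induction hX using Submodule.span_induction with
  | mem X hX =>
    obtain ⟨γ, ⟨h0, hadd, hd⟩, hK⟩ := hX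
    refine Submodule.subset_span ⟨fun t => conj s (γ t), ⟨?_, ?_, ?_⟩, ?_⟩
    · simp [h0, conj]
    · intro a b; simp [hadd, conj, mul_assoc]
    · have := (mdiff_conj I s (γ 0)).hasMFDerivAt.comp 0 hd
      refine this.congr_mfderiv ?_
      have h1 := mfderiv_conj_congr I s (γ 0) h0 X
      ext
      change (show E →L[ℝ] E from mfderiv I I (conj s) (γ 0)) ((1 : ℝ) • (X : E)) =
        (1 : ℝ) • (Ad I s X : E)
      rw [one_smul, one_smul]
      exact h1
    · intro t; exact K.mul_mem (K.mul_mem hs (hK t)) (K.inv_mem hs)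
  | zero => rw [map_zero]; exact zero_mem _
  | add a b _ _ ha hb => rw [map_add]; exact add_mem ha hb
  | smul c a _ ha => rw [map_smul]; exact Submodule.smul_mem _ _ ha

theorem Ad_mem_mm {s : G} (hs : s ∈ K) {Y : GroupLieAlgebra I G} (hY : Y ∈ mm I K) :
    Ad I s Y ∈ mm I K := fun X hX => by
  rw [Kil_Ad_left]
  exact hY _ (Ad_mem_lieK I K (K.inv_mem hs) hX)

/-- The adjoint action of `K` on `𝔪`. -/
def AdK (s : K) : mm I K →ₗ[ℝ] mm I K :=
  (Ad I (s : G)).restrict fun _ hY => Ad_mem_mm I K s.2 hY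

open Classical in
/-- The projection `P` of the Lie algebra of `G` onto `𝔪` along the Lie algebra of `K`. (The two are
complementary when `G` is compact and semisimple, since then `Kil` is definite.) -/
def projm : GroupLieAlgebra I G →ₗ[ℝ] mm I K :=
  if h : IsCompl (mm I K) (lieK I K) then (mm I K).projectionOnto (lieK I K) h else 0

theorem projm_Ad (s : K) (X : GroupLieAlgebra I G) :
    projm I K (Ad I (s : G) X) = AdK I K s (projm I K X) := by
  unfold projm
  split_ifs with h
  · have hX := Submodule.projection_add_projection_eq_self h X
    set a := (mm I K).projectionOnto (lieK I K) h X with ha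
    have h1 : X - a ∈ lieK I K := Submodule.sub_projection_mem h X
    have h2 : X = (a : GroupLieAlgebra I G) + (X - a) := by abel
    conv_lhs => rw [h2]
    rw [map_add, map_add, (Submodule.projectionOnto_apply_eq_zero_iff h).2
      (Ad_mem_lieK I K s.2 h1), add_zero]
    exact Submodule.projectionOnto_apply_left h (AdK I K s a)
  · simp


theorem contMDiff_Ad (X : GroupLieAlgebra I G) :
    ContMDiff I 𝓘(ℝ, E) ∞ (fun y : G => AdL I y X) := by
  intro x
  have hconj : ContMDiffAt (I.prod I) I ∞ (Function.uncurry (conj : G → G → G)) (x, 1) := by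
    have : ContMDiff (I.prod I) I ∞ (fun p : G × G => p.1 * p.2 * p.1⁻¹) :=
      (contMDiff_fst.mul contMDiff_snd).mul contMDiff_fst.inv
    exact this.contMDiffAt
  have h := ContMDiffAt.mfderiv (I := I) (I' := I) (J := I) (m := ∞) (n := ∞)
    (conj : G → G → G) (fun _ : G => (1 : G)) hconj contMDiffAt_const (by simp)
  have heq : ∀ y : G, inTangentCoordinates I I (fun _ : G => (1 : G)) (fun y : G => conj y 1)
      (AdL I) x y = AdL I y := by
    intro y
    have hb : ∀ z : G, z = 1 → ∀ w : G, w = 1 → ∀ v : E,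
        (tangentBundleCore I G).coordChange (achart H z) (achart H w) z v = v := by
      rintro z rfl w rfl v
      exact (tangentBundleCore I G).coordChange_self _ _ (mem_chart_source H _) _
    refine (inTangentCoordinates_eq (I := I) (I' := I) (fun _ : G => (1 : G))
      (fun y : G => conj y 1) (AdL I) (x₀ := x) (x := y) (mem_chart_source H _)
      (by simp only [conj_one]; exact mem_chart_source H _)).trans ?_
    ext v
    simp only [ContinuousLinearMap.comp_apply]
    rw [hb _ (conj_one y) _ (conj_one x), hb 1 rfl 1 rfl]
  have h' : ContMDiffAt I 𝓘(ℝ, E →L[ℝ] E) ∞ (AdL I : G → E →L[ℝ] E) x :=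
    h.congr_of_eventuallyEq (Filter.Eventually.of_forall fun y => (heq y).symm)
  exact h'.clm_apply contMDiffAt_const

/-! ### Smooth functions, vector fields and directional derivatives -/

/-- Smoothness of a function on `G` with values in a finite-dimensional real vector space: all its
components are smooth. -/
def SmoothTo {F : Type*} [AddCommGroup F] [Module ℝ F] (f : G → F) : Prop :=
  ∀ l : F →ₗ[ℝ] ℝ, ContMDiff I 𝓘(ℝ, ℝ) ∞ fun x => l (f x)

/-- The derivative at `t = 0` of `t ↦ f (x exp (t X))`, that is, the derivative of `f` at `x` along
the left-invariant vector field of `X`. -/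
def dirDeriv (f : G → ℝ) (x : G) (X : GroupLieAlgebra I G) : ℝ :=
  mfderiv I 𝓘(ℝ, ℝ) f x (mulInvariantVectorField X x)

/-- The derivative at `t = 0` of `t ↦ f (x exp (t X))` for a function `f` with values in a
finite-dimensional real vector space, computed componentwise. -/
def vecDeriv {F : Type*} [AddCommGroup F] [Module ℝ F] [Module.Finite ℝ F] (f : G → F) (x : G)
    (X : GroupLieAlgebra I G) : F :=
  ∑ i, dirDeriv I (fun y => (Module.finBasis ℝ F).coord i (f y)) x X • Module.finBasis ℝ F i

/-- The algebra `A` of smooth real functions on `G / K`, viewed as functions on `G`. -/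
def smoothFun : Subalgebra ℝ (G → ℝ) where
  carrier := {f | ContMDiff I 𝓘(ℝ, ℝ) ∞ f ∧ ∀ (x : G) (s : K), f (x * s) = f x}
  mul_mem' := fun {f g} hf hg => ⟨hf.1.mul hg.1, fun x s => by simp [hf.2, hg.2]⟩
  add_mem' := fun {f g} hf hg => ⟨hf.1.add hg.1, fun x s => by simp [hf.2, hg.2]⟩
  algebraMap_mem' := fun r => ⟨contMDiff_const, fun _ _ => rfl⟩

/-- The space of (tangent) vector fields on `G / K`. -/
def vectorField : Submodule ℝ (G → mm I K) where
  carrier := {V | SmoothTo I V ∧ ∀ (x : G) (s : K), V (x * s) = AdK I K s⁻¹ (V x)}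
  add_mem' := fun {V W} hV hW => by
    refine ⟨fun l => ?_, fun x s => by simp [hV.2, hW.2]⟩
    have := (hV.1 l).add (hW.1 l)
    convert this using 2 with x
    exact l.map_add (V x) (W x)
  zero_mem' := ⟨fun l => by simpa using contMDiff_const, fun x s => by simp⟩
  smul_mem' := fun c V hV => by
    refine ⟨fun l => ?_, fun x s => by simp [hV.2]⟩
    have := (contMDiff_const (c := c)).mul (hV.1 l)
    convert this using 2 with x
    exact l.map_smul c (V x)

/-- The product of a smooth function and a vector field, which makes the vector fields an
`A`-module. -/
def mulField (f : smoothFun I K) (V : vectorField I K) : vectorField I K :=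
  ⟨fun x => f.1 x • V.1 x, fun l => by
    have := f.2.1.mul (V.2.1 l)
    convert this using 2 with x
    exact l.map_smul (f.1 x) (V.1 x), fun x s => by
    change f.1 (x * s) • V.1 (x * s) = AdK I K s⁻¹ (f.1 x • V.1 x)
    rw [f.2.2 x s, V.2.2 x s, map_smul]⟩

/-- The action of `G` on vector fields by translation. -/
def translate (a : G) (V : vectorField I K) : vectorField I K :=
  ⟨fun x => V.1 (a⁻¹ * x), fun l => (V.2.1 l).comp contMDiff_mul_left, fun x s => by
    change V.1 (a⁻¹ * (x * s)) = _
    rw [← mul_assoc]; exact V.2.2 _ s⟩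

/-- The fundamental vector field `X̂ (x) = - P Ad_x⁻¹ X`. -/
def fundField (X : GroupLieAlgebra I G) : vectorField I K :=
  ⟨fun x => -projm I K (Ad I x⁻¹ X), by
    intro l
    have h1 : ContMDiff I 𝓘(ℝ, E) ∞ fun x : G => AdL I x⁻¹ X :=
      (contMDiff_Ad I X).comp (contMDiff_inv I ∞)
    let L : E →ₗ[ℝ] ℝ := l.comp (-(projm I K))
    have h2 : ContMDiff I 𝓘(ℝ, ℝ) ∞ fun x : G => L.toContinuousLinearMap (AdL I x⁻¹ X) :=
      L.toContinuousLinearMap.contMDiff.comp h1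
    exact h2, by
    intro x s
    change -projm I K (Ad I (x * s)⁻¹ X) = AdK I K s⁻¹ (-projm I K (Ad I x⁻¹ X))
    rw [mul_inv_rev, Ad_mul]
    have := projm_Ad I K s⁻¹ (Ad I x⁻¹ X)
    rw [InvMemClass.coe_inv] at this
    rw [this, map_neg]⟩

/-- A vector field whose value at `x` is `w`, namely the fundamental vector field of `- Ad_x w`. -/
def extendField (x : G) (w : mm I K) : vectorField I K :=
  fundField I K (-(Ad I x (w : GroupLieAlgebra I G)))

/-- The canonical connection: `(∇ᶜ_V W) (x)` is the derivative at `t = 0` of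
`t ↦ W (x exp (t V(x)))`. -/
def canonical (V W : vectorField I K) (x : G) : mm I K :=
  vecDeriv I W.1 x (V.1 x : GroupLieAlgebra I G)

/-- A connection on the module of vector fields of `G / K`. -/
structure Connection where
  /-- `∇_V W`. -/
  toFun : vectorField I K → vectorField I K → vectorField I K
  add_left : ∀ U V W, toFun (U + V) W = toFun U W + toFun V W
  smul_left : ∀ (f : smoothFun I K) V W, toFun (mulField I K f V) W = mulField I K f (toFun V W)
  add_right : ∀ U V W, toFun U (V + W) = toFun U V + toFun U W
  leibniz : ∀ (f : smoothFun I K) V W (x : G), (toFun V (mulField I K f W)).1 x =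
    f.1 x • (toFun V W).1 x + dirDeriv I f.1 x (V.1 x : GroupLieAlgebra I G) • W.1 x

variable {I K}

/-- Invariance of a connection under translation by `G`. -/
def Connection.IsInvariant (D : Connection I K) : Prop :=
  ∀ (a : G) (V W : vectorField I K),
    D.toFun (translate I K a V) (translate I K a W) = translate I K a (D.toFun V W)

/-- `(L_V W) (x)` for `L = ∇ - ∇ᶜ`. -/
def Connection.diff (D : Connection I K) (V W : vectorField I K) (x : G) : mm I K :=
  (D.toFun V W).1 x - canonical I K V W x

/-- The endomorphism `L_V (x)` of `𝔪`, determined by `(L_V W) (x) = L_V (x) (W (x))`: it sends `w` to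
the value at `x` of `L_V W` for a vector field `W` with `W (x) = w`. -/
def Connection.diffEnd (D : Connection I K) (V : vectorField I K) (x : G) (w : mm I K) : mm I K :=
  D.diff V (extendField I K x w) x

variable (I K)

/-- An almost-Hermitian structure on `G / K`: an inner product `g` on `𝔪` and a complex structure `J`
on `𝔪` orthogonal for `g`, both invariant for the adjoint action of `K`. -/
structure AlmostHermitian extends HermSpace (mm I K) where
  g_Ad : ∀ (s : K) X Y, g (AdK I K s X) (AdK I K s Y) = g X Y
  J_Ad : ∀ (s : K) X, J (AdK I K s X) = AdK I K s (J X)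

variable {I K}

namespace AlmostHermitian

variable (h : AlmostHermitian I K)

/-- Compatibility of a connection with the Riemannian metric. -/
def IsCompatible (D : Connection I K) : Prop :=
  ∀ (U V W : vectorField I K) (x : G),
    dirDeriv I (fun y => h.g (V.1 y) (W.1 y)) x (U.1 x : GroupLieAlgebra I G) =
      h.g ((D.toFun U V).1 x) (W.1 x) + h.g (V.1 x) ((D.toFun U W).1 x)

/-- `J` acting pointwise on vector fields. -/
def Jfield (V : vectorField I K) : vectorField I K :=
  ⟨fun x => h.J (V.1 x), fun l => V.2.1 (l ∘ₗ h.J), fun x s => by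
    change h.J (V.1 (x * s)) = AdK I K s⁻¹ (h.J (V.1 x))
    rw [V.2.2, h.J_Ad]⟩

/-- A connection commutes with `J`. -/
def CommutesWithJ (D : Connection I K) : Prop :=
  ∀ V W : vectorField I K, D.toFun V (h.Jfield W) = h.Jfield (D.toFun V W)

/-- Standard module frames: finite families of vector fields such that
`V = ∑ⱼ W_j ⟨W_j, V⟩_A` for every vector field `V`. -/
def IsStandardFrame {n : ℕ} (W : Fin n → vectorField I K) : Prop :=
  ∀ (V : vectorField I K) (x : G), V.1 x = ∑ j, h.g ((W j).1 x) (V.1 x) • (W j).1 x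

/-- The action of `s ∈ K` on spinors by exterior-algebra automorphisms. -/
def AdSpin (s : K) : h.Spinor →ₐ[ℂ] h.Spinor :=
  ExteriorAlgebra.map (h.complexify (AdK I K s) fun X => (h.J_Ad s X).symm)

/-- The spinor fields on `G / K` for a character `χ` of `K`: smooth functions `ψ` from `G` to spinors
with `ψ (x s) = conj (χ s) Ad_s⁻¹ (ψ x)`. -/
def IsSpinorField (χ : K →ₜ* Circle) (ψ : G → h.Spinor) : Prop :=
  SmoothTo I ψ ∧
    ∀ (x : G) (s : K), ψ (x * s) = starRingEnd ℂ (χ s : ℂ) • h.AdSpin s⁻¹ (ψ x)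

open Classical in
/-- The extension to spinors, as a derivation, of the endomorphism `L_V (x)` of `𝔪`. (It is real-linear
and commutes with `J` whenever the connection commutes with `J`.) -/
def diffSpin (D : Connection I K) (V : vectorField I K) (x : G) : h.Spinor →ₗ[ℂ] h.Spinor :=
  if hL : ∃ l : h.MJ →ₗ[ℂ] h.MJ, ∀ w, l (h.toMJ w) = h.toMJ (D.diffEnd V x w) then
    h.extDer hL.choose
  else 0

/-- The connection on spinor fields: `∇ˢ_V ψ = ∇ᶜ_V ψ + Lˢ_V ψ`. -/
def spinConnection (D : Connection I K) (V : vectorField I K) (ψ : G → h.Spinor) (x : G) :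
    h.Spinor :=
  vecDeriv I ψ x (V.1 x : GroupLieAlgebra I G) + h.diffSpin D V x (ψ x)

theorem nondegenerate : h.g.Nondegenerate := by
  refine ⟨fun X hX => ?_, fun X hX => ?_⟩ <;>
  · by_contra hne
    exact (h.pos X hne).ne' (hX X)

/-- The Dirac operator `D ψ = κ (grad ψ)`. The value at `x` of `grad ψ` is the element
`∑ₚ eᵖ ⊗ (∇ˢ_{eₚ} ψ) (x)` of `𝔪 ⊗ 𝒮` which corresponds to the linear map `v ↦ (∇ˢ_v ψ) (x)` under the
identification of `𝔪` with its dual by `g`; here `eₚ` is a basis of `𝔪` and `eᵖ` is its dual basis for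
`g`. -/
def dirac (D : Connection I K) (ψ : G → h.Spinor) (x : G) : h.Spinor :=
  ∑ p, h.clifford (h.g.dualBasis h.nondegenerate (Module.finBasis ℝ (mm I K)) p)
    (h.spinConnection D (extendField I K x (Module.finBasis ℝ (mm I K) p)) ψ x)

/-- Formal self-adjointness of the Dirac operator on the spinor fields for `χ`, for the `L²` inner
product `∫ ⟨ψ, φ⟩` with respect to the measure `μ` on `G`. -/
def IsFormallySelfAdjoint [MeasurableSpace G] (μ : MeasureTheory.Measure G) (D : Connection I K)
    (χ : K →ₜ* Circle) : Prop :=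
  ∀ ψ φ : G → h.Spinor, h.IsSpinorField χ ψ → h.IsSpinorField χ φ →
    ∫ x, h.spinInner (h.dirac D ψ x) (φ x) ∂μ = ∫ x, h.spinInner (ψ x) (h.dirac D φ x) ∂μ

/-- The operator `S` on `𝔪` with `g (X, Y) = Kil (S X, Y)`, which exists uniquely because `Kil` is
definite when `G` is compact and semisimple. -/
def metricOp : mm I K →ₗ[ℝ] mm I K :=
  Classical.epsilon fun S : mm I K →ₗ[ℝ] mm I K =>
    ∀ X Y : mm I K, h.g X Y = Kil I G (S X : GroupLieAlgebra I G) (Y : GroupLieAlgebra I G)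

/-- `S^{1/2}`, the unique square root of `S` which is symmetric and positive for `Kil`. -/
def metricOpSqrt : mm I K →ₗ[ℝ] mm I K :=
  Classical.epsilon fun R : mm I K →ₗ[ℝ] mm I K =>
    (∀ X Y : mm I K, Kil I G (R X : GroupLieAlgebra I G) (Y : GroupLieAlgebra I G) =
      Kil I G (X : GroupLieAlgebra I G) (R Y : GroupLieAlgebra I G)) ∧
    (∀ X : mm I K, X ≠ 0 → 0 < Kil I G (R X : GroupLieAlgebra I G) (X : GroupLieAlgebra I G)) ∧
    R ∘ₗ R = h.metricOp

/-- `S^{-1/2}`, the inverse of `S^{1/2}` in the ring of endomorphisms of `𝔪`. -/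
def metricOpInvSqrt : mm I K →ₗ[ℝ] mm I K :=
  Ring.inverse (h.metricOpSqrt : Module.End ℝ (mm I K))

/-- Orthonormal bases of `𝔪` for `g`. -/
def IsOrthonormal (Y : Module.Basis (Fin (Module.finrank ℝ (mm I K))) ℝ (mm I K)) : Prop :=
  ∀ p q, h.g (Y p) (Y q) = if p = q then 1 else 0

/-- The sum `∑ₚ L_{X̂ₚ} (e) (S^{-1/2} Yₚ)` with `Xₚ = S^{1/2} Yₚ`. -/
def ikedaSum (D : Connection I K)
    (Y : Module.Basis (Fin (Module.finrank ℝ (mm I K))) ℝ (mm I K)) : mm I K :=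
  ∑ p, D.diffEnd (fundField I K (h.metricOpSqrt (Y p) : GroupLieAlgebra I G)) 1
    (h.metricOpInvSqrt (Y p))

end AlmostHermitian

end Group

end HomDirac

end

/-!
On a compact group the Haar measure is also right invariant, so left-invariant derivatives have
integral zero. Leibniz' rule and the skewness of `L_v` turn `⟨D ψ, φ⟩ - ⟨ψ, D φ⟩` into a divergence
plus `⟨ψ, κ (Z) φ⟩`, where `Z = ∑ₚ L_{eₚ} eᵖ`, and only the second term survives integration. Hence
`Z = 0` implies formal self-adjointness; conversely take `φ = F` and `ψ = F Z`, where `F` is a bump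
function at `1` averaged over `K` against `χ`: the integral becomes `i ⟨Z, Z⟩ ∫ |F|²`.

As `L` is tensorial and invariant, it is one `Ad (K)`-equivariant bilinear map `𝔪 × 𝔪 → 𝔪`, and `Z`
is its trace for `g`, computed by any pair of families dual to each other. A standard module frame
at a point of `G` is such a pair, and so are `S^{1/2} Y_p` and `S^{-1/2} Y_p`, with
`X̂_p (e) = -S^{1/2} Y_p`. A standard module frame is obtained by applying `S^{-1/2}`, which
commutes with `Ad (K)`, to the fundamental fields of a `Kil`-orthonormal basis of the Lie algebra.

`Kil` is positive definite because `Ad` preserves an averaged inner product, so that every `ad X` is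
skew for it.
-/

noncomputable section

namespace HomDirac

open MeasureTheory

section InnerForms

variable {V : Type*} [AddCommGroup V] [Module ℝ V]

/-- Inner products as symmetric positive definite bilinear forms, which leaves the topology and
norm of the underlying space free. -/
structure IsInnerForm (B : LinearMap.BilinForm ℝ V) : Prop where
  symm : ∀ X Y, B X Y = B Y X
  pos : ∀ X, X ≠ 0 → 0 < B X X

/-- The families `a` and `b` are dual for `g`, that is `∑ⱼ aⱼ ⊗ bⱼ` represents the inverse of `g`.
They need not be linearly independent, so that frames are covered along with bases. -/
def IsDualPair {ι : Type*} [Fintype ι] (g : LinearMap.BilinForm ℝ V) (a b : ι → V) : Prop :=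
  ∀ v, ∑ j, g (b j) v • a j = v

namespace IsInnerForm

theorem nondegenerate {B : LinearMap.BilinForm ℝ V} (hB : IsInnerForm B) : B.Nondegenerate := by
  constructor <;> intro X hX <;> by_contra hne
  all_goals exact (hB.pos X hne).ne' (hX X)

theorem nonneg {B : LinearMap.BilinForm ℝ V} (hB : IsInnerForm B) (X : V) : 0 ≤ B X X := by
  obtain rfl | hX := eq_or_ne X 0
  · simp
  · exact (hB.pos X hX).le

theorem restrict {B : LinearMap.BilinForm ℝ V} (hB : IsInnerForm B) (W : Submodule ℝ V) :
    IsInnerForm (B.restrict W) where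
  symm X Y := hB.symm X Y
  pos X hX := hB.pos X fun h => hX (Subtype.ext h)

/-- The inner product space structure given by an inner form. -/
abbrev core {B : LinearMap.BilinForm ℝ V} (hB : IsInnerForm B) : InnerProductSpace.Core ℝ V where
  inner X Y := B X Y
  conj_inner_symm X Y := hB.symm Y X
  re_inner_nonneg X := hB.nonneg X
  add_left X Y Z := by simp
  smul_left X Y r := by simp
  definite X hX := by
    by_contra hne
    exact (hB.pos X hne).ne' hX

theorem exists_orthonormal_basis [FiniteDimensional ℝ V] {B : LinearMap.BilinForm ℝ V}
    (hB : IsInnerForm B) : ∃ b : Module.Basis (Fin (Module.finrank ℝ V)) ℝ V,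
      ∀ i j, B (b i) (b j) = if i = j then 1 else 0 := by
  let := hB.core.toNormedAddCommGroup
  let := InnerProductSpace.ofCore hB.core.toCore
  let b := stdOrthonormalBasis ℝ V
  refine ⟨b.toBasis, ?_⟩
  rw [OrthonormalBasis.coe_toBasis]
  exact orthonormal_iff_ite.1 b.orthonormal

end IsInnerForm

theorem IsDualPair.sum_eq {ι κ N : Type*} [Fintype ι] [Fintype κ] [AddCommGroup N] [Module ℝ N]
    {g : LinearMap.BilinForm ℝ V} (hg : g.Nondegenerate) {a b : ι → V} {c d : κ → V}
    (hab : IsDualPair g a b) (hcd : IsDualPair g c d) (β : V →ₗ[ℝ] V →ₗ[ℝ] N) :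
    ∑ j, β (a j) (b j) = ∑ k, β (c k) (d k) := by
  have expand_flip (w : V) : ∑ k, g w (c k) • d k = w := by
    refine sub_eq_zero.1 (hg.1 _ fun v => ?_)
    rw [map_sub, LinearMap.sub_apply, sub_eq_zero]
    simpa [mul_comm] using congrArg (g w) (hcd v)
  calc ∑ j, β (a j) (b j) = ∑ j, ∑ k, g (b j) (c k) • β (a j) (d k) :=
        Finset.sum_congr rfl fun j _ => by
          conv_lhs => rw [← expand_flip (b j)]
          simp only [map_sum, map_smul]
    _ = ∑ k, ∑ j, g (b j) (c k) • β (a j) (d k) := Finset.sum_comm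
    _ = ∑ k, β (c k) (d k) := Finset.sum_congr rfl fun k _ => by
          conv_rhs => rw [← hab (c k)]
          simp only [map_sum, map_smul, LinearMap.sum_apply, LinearMap.smul_apply]

theorem isDualPair_of_basis {ι : Type*} [Fintype ι] [DecidableEq ι]
    {g : LinearMap.BilinForm ℝ V} {Y : Module.Basis ι ℝ V} {b : ι → V}
    (hY : ∀ p q, g (b p) (Y q) = if p = q then 1 else 0) : IsDualPair g Y b := fun v => by
  conv_rhs => rw [← Y.sum_repr v]
  refine Finset.sum_congr rfl fun p _ => ?_
  rw [← Y.sum_repr v, map_sum]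
  simp [hY]

end InnerForms

section SquareRoot

open Polynomial

open scoped InnerProductSpace

/-- Interpolating the square root at the eigenvalues makes the root a polynomial in the operator,
so that it commutes with every symmetry of the operator. -/
theorem exists_polynomial_sqrt {V : Type*} [NormedAddCommGroup V] [InnerProductSpace ℝ V]
    [FiniteDimensional ℝ V] {S : V →ₗ[ℝ] V} (hS : S.IsSymmetric)
    (hpos : ∀ x, x ≠ 0 → 0 < ⟪S x, x⟫_ℝ) :
    ∃ p : ℝ[X], (aeval S p).IsSymmetric ∧ (∀ x, x ≠ 0 → 0 < ⟪aeval S p x, x⟫_ℝ) ∧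
      aeval S p ∘ₗ aeval S p = S := by
  classical
  let b := hS.eigenvectorBasis rfl
  let l := hS.eigenvalues rfl
  have hl (i) : 0 < l i := by
    have := hpos (b i) (b.orthonormal.ne_zero i)
    rwa [hS.apply_eigenvectorBasis rfl i, inner_smul_left, real_inner_self_eq_norm_sq,
      b.norm_eq_one, one_pow, mul_one] at this
  let p := Lagrange.interpolate (Finset.univ.image l) id Real.sqrt
  have hp (i) : aeval S p (b i) = √(l i) • b i := by
    rw [Module.End.aeval_apply_of_hasEigenvector (hS.hasEigenvector_eigenvectorBasis rfl i)]
    congr 1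
    exact Lagrange.eval_interpolate_at_node Real.sqrt (Set.injOn_id _)
      (Finset.mem_image_of_mem l (Finset.mem_univ i))
  have inner_aeval (x y : V) :
      ⟪aeval S p x, y⟫_ℝ = ∑ i, √(l i) * (⟪b i, x⟫_ℝ * ⟪b i, y⟫_ℝ) := by
    conv_lhs => rw [← b.sum_repr' x, map_sum, sum_inner]
    refine Finset.sum_congr rfl fun i _ => ?_
    rw [map_smul, hp, inner_smul_left, inner_smul_left, RCLike.conj_to_real, RCLike.conj_to_real]
    ring
  refine ⟨p, fun x y => ?_, fun x hx => ?_, b.toBasis.ext fun i => ?_⟩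
  · rw [inner_aeval, real_inner_comm, inner_aeval]
    simp only [mul_comm]
  · obtain ⟨i, hi⟩ : ∃ i, ⟪b i, x⟫_ℝ ≠ 0 := by
      by_contra! h
      exact hx (b.toBasis.ext_elem fun i => by simp [b.repr_apply_apply, h])
    rw [inner_aeval]
    exact Finset.sum_pos' (fun j _ => mul_nonneg (Real.sqrt_nonneg _) (mul_self_nonneg _))
      ⟨i, Finset.mem_univ i, mul_pos (Real.sqrt_pos.2 (hl i)) (mul_self_pos.2 hi)⟩
  · rw [b.coe_toBasis, LinearMap.comp_apply, hp, map_smul, hp, smul_smul,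
      Real.mul_self_sqrt (hl i).le]
    exact (hS.apply_eigenvectorBasis rfl i).symm

theorem IsInnerForm.exists_polynomial_sqrt {V : Type*} [AddCommGroup V] [Module ℝ V]
    [FiniteDimensional ℝ V] {B : LinearMap.BilinForm ℝ V} (hB : IsInnerForm B) {S : V →ₗ[ℝ] V}
    (hS : ∀ X Y, B (S X) Y = B X (S Y)) (hpos : ∀ X, X ≠ 0 → 0 < B (S X) X) :
    ∃ p : ℝ[X], (∀ X Y, B (aeval S p X) Y = B X (aeval S p Y)) ∧
      (∀ X, X ≠ 0 → 0 < B (aeval S p X) X) ∧ aeval S p ∘ₗ aeval S p = S := by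
  let := hB.core.toNormedAddCommGroup
  let := InnerProductSpace.ofCore hB.core.toCore
  exact HomDirac.exists_polynomial_sqrt hS hpos

end SquareRoot

section HaarMeasure

open Measure

/-- Compact groups are unimodular: `μ` and its right translates are proportional, with the same
finite positive total mass. -/
theorem isMulRightInvariant_of_compactSpace {G : Type*} [Group G] [TopologicalSpace G]
    [IsTopologicalGroup G] [CompactSpace G] [MeasurableSpace G] [BorelSpace G] (μ : Measure G)
    [μ.IsHaarMeasure] : μ.IsMulRightInvariant where
  map_mul_right_eq_self g := by
    have map_eq_smul := isMulInvariant_eq_smul_of_compactSpace (map (· * g) μ) μ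
    have mass : (map (· * g) μ) Set.univ = μ Set.univ := by
      rw [map_apply (measurable_mul_const g) MeasurableSet.univ, Set.preimage_univ]
    have mass_ne_zero : μ Set.univ ≠ 0 := (isOpen_univ.measure_pos μ Set.univ_nonempty).ne'
    rw [map_eq_smul] at mass ⊢
    rw [Measure.smul_apply, ENNReal.smul_def, smul_eq_mul,
      ENNReal.mul_eq_right mass_ne_zero (measure_ne_top μ _), ENNReal.coe_eq_one] at mass
    rw [mass, one_smul]

end HaarMeasure

namespace HermSpace

variable {M : Type*} [AddCommGroup M] [Module ℝ M] (h : HermSpace M)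

theorem isInnerForm : IsInnerForm h.g := ⟨h.symm, h.pos⟩

@[elab_as_elim]
theorem spinor_induction {C : h.Spinor → Prop} (smul_one : ∀ z : ℂ, C (z • 1))
    (add : ∀ ψ φ, C ψ → C φ → C (ψ + φ))
    (ι_mul : ∀ (X : M) ψ, C ψ → C (ExteriorAlgebra.ι ℂ (h.toMJ X) * ψ)) (ψ : h.Spinor) : C ψ := by
  refine CliffordAlgebra.left_induction (Q := (0 : QuadraticForm ℂ h.MJ)) (fun z => ?_) add
    (fun ψ X hψ => ι_mul (h.toMJ.symm X) ψ hψ) ψ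
  rw [Algebra.algebraMap_eq_smul_one]
  exact smul_one z

section SpinorInner

theorem spinInner_smul_left (c : ℂ) (ψ φ : h.Spinor) :
    h.spinInner (c • ψ) φ = starRingEnd ℂ c * h.spinInner ψ φ := by
  simp [spinInner]

theorem spinInner_smul_right (c : ℂ) (ψ φ : h.Spinor) :
    h.spinInner ψ (c • φ) = c * h.spinInner ψ φ := by
  simp [spinInner]

/-- The inner product of spinors as a real bilinear map, the form to which the product rule for
directional derivatives applies. -/
def spinForm : h.Spinor →ₗ[ℝ] h.Spinor →ₗ[ℝ] ℂ :=
  LinearMap.mk₂ ℝ h.spinInner (fun ψ ψ' φ => by simp [spinInner])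
    (fun c ψ φ => by
      rw [← Complex.coe_smul, spinInner_smul_left, Complex.conj_ofReal, Complex.real_smul])
    (fun ψ φ φ' => by simp [spinInner])
    (fun c ψ φ => by rw [← Complex.coe_smul, spinInner_smul_right, Complex.real_smul])

theorem spinForm_apply (ψ φ : h.Spinor) : h.spinForm ψ φ = h.spinInner ψ φ := rfl

theorem spinInner_add_left (ψ ψ' φ : h.Spinor) :
    h.spinInner (ψ + ψ') φ = h.spinInner ψ φ + h.spinInner ψ' φ := by
  simp only [← spinForm_apply, map_add, LinearMap.add_apply]

theorem spinInner_add_right (ψ φ φ' : h.Spinor) :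
    h.spinInner ψ (φ + φ') = h.spinInner ψ φ + h.spinInner ψ φ' := by
  simp only [← spinForm_apply, map_add]

theorem spinInner_sub_left (ψ ψ' φ : h.Spinor) :
    h.spinInner (ψ - ψ') φ = h.spinInner ψ φ - h.spinInner ψ' φ := by
  simp only [← spinForm_apply, map_sub, LinearMap.sub_apply]

theorem spinInner_sub_right (ψ φ φ' : h.Spinor) :
    h.spinInner ψ (φ - φ') = h.spinInner ψ φ - h.spinInner ψ φ' := by
  simp only [← spinForm_apply, map_sub]

theorem spinInner_zero_right (ψ : h.Spinor) : h.spinInner ψ 0 = 0 := by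
  simp only [← spinForm_apply, map_zero]

end SpinorInner

section Clifford

theorem contractLeft_ι_mul (d : Module.Dual ℂ h.MJ) (X : h.MJ) (ψ : h.Spinor) :
    CliffordAlgebra.contractLeft (Q := (0 : QuadraticForm ℂ h.MJ)) d
        (ExteriorAlgebra.ι ℂ X * ψ) =
      d X • ψ - ExteriorAlgebra.ι ℂ X *
        CliffordAlgebra.contractLeft (Q := (0 : QuadraticForm ℂ h.MJ)) d ψ :=
  CliffordAlgebra.contractLeft_ι_mul ..

theorem annihilation_ι_mul (X : M) (Z : h.MJ) (ψ : h.Spinor) :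
    h.annihilation X (ExteriorAlgebra.ι ℂ Z * ψ) =
      h.herm X Z • ψ - ExteriorAlgebra.ι ℂ Z * h.annihilation X ψ :=
  h.contractLeft_ι_mul ..

theorem annihilation_one (X : M) : h.annihilation X 1 = 0 :=
  CliffordAlgebra.contractLeft_one (Q := (0 : QuadraticForm ℂ h.MJ)) _

theorem algebraMapInv_ι_mul (X : h.MJ) (ψ : h.Spinor) :
    ExteriorAlgebra.algebraMapInv (ExteriorAlgebra.ι ℂ X * ψ) = (0 : ℂ) := by
  simp [ExteriorAlgebra.algebraMapInv]

theorem spinInner_creation_left (X : M) (ψ φ : h.Spinor) :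
    h.spinInner (ExteriorAlgebra.ι ℂ (h.toMJ X) * ψ) φ = h.spinInner ψ (h.annihilation X φ) := by
  induction φ using h.spinor_induction generalizing ψ with
  | smul_one z =>
    rw [map_smul, annihilation_one, smul_zero, spinInner_zero_right, spinInner_smul_right,
      spinInner_one, algebraMapInv_ι_mul, map_zero, mul_zero]
  | add φ φ' hφ hφ' => rw [spinInner_add_right, hφ, hφ', map_add, spinInner_add_right]
  | ι_mul Y φ ih =>
    rw [spinInner_ι_mul, annihilation_ι_mul, annihilation_ι_mul, spinInner_sub_left,
      spinInner_smul_left, spinInner_sub_right, spinInner_smul_right, ih, herm_symm,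
      spinInner_ι_mul]

theorem clifford_apply (X : M) (ψ : h.Spinor) : h.clifford X ψ =
    Complex.I • (h.annihilation X ψ + ExteriorAlgebra.ι ℂ (h.toMJ X) * ψ) := rfl

theorem spinInner_clifford_left (X : M) (ψ φ : h.Spinor) :
    h.spinInner (h.clifford X ψ) φ = -h.spinInner ψ (h.clifford X φ) := by
  rw [clifford_apply, clifford_apply, spinInner_smul_left, spinInner_smul_right,
    spinInner_add_left, spinInner_add_right, spinInner_creation_left, spinInner_ι_mul,
    Complex.conj_I]
  ring

theorem clifford_add (X Y : M) (ψ : h.Spinor) :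
    h.clifford (X + Y) ψ = h.clifford X ψ + h.clifford Y ψ := by
  simp only [clifford_apply, annihilation, herm_add, map_add, LinearMap.add_apply, add_mul,
    ← smul_add]
  congr 1
  abel

theorem clifford_zero (ψ : h.Spinor) : h.clifford 0 ψ = 0 :=
  map_zero (AddMonoidHom.mk' (fun X => h.clifford X ψ) fun X Y => h.clifford_add X Y ψ)

theorem clifford_sum {ι : Type*} (s : Finset ι) (X : ι → M) (ψ : h.Spinor) :
    h.clifford (∑ i ∈ s, X i) ψ = ∑ i ∈ s, h.clifford (X i) ψ :=
  map_sum (AddMonoidHom.mk' (fun X => h.clifford X ψ) fun X Y => h.clifford_add X Y ψ) X s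

theorem spinInner_ι_clifford_one (Z : M) :
    h.spinInner (ExteriorAlgebra.ι ℂ (h.toMJ Z)) (h.clifford Z 1) =
      Complex.I * h.herm Z (h.toMJ Z) := by
  rw [clifford_apply, annihilation_one, zero_add, spinInner_smul_right, spinInner_ι_mul,
    ← mul_one (ExteriorAlgebra.ι ℂ (h.toMJ Z)), annihilation_ι_mul, annihilation_one, mul_zero,
    sub_zero, spinInner_smul_left, spinInner_one, map_one, map_one, mul_one, herm_symm]

theorem herm_self_ne_zero {Z : M} (hZ : Z ≠ 0) : h.herm Z (h.toMJ Z) ≠ 0 := fun h0 => by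
  have := congrArg Complex.re h0
  simp [herm, (h.pos Z hZ).ne'] at this

end Clifford

section Derivation

variable {l : M →ₗ[ℝ] M} (hJ : ∀ X, l (h.J X) = h.J (l X))

theorem herm_comp_complexify (hl : ∀ X Y, h.g (l X) Y = -h.g X (l Y)) (X : M) :
    h.herm X ∘ₗ h.complexify l hJ = -h.herm (l X) := by
  ext Y
  simp [herm, complexify, ← hJ, hl]
  ring

variable [Module.Finite ℝ M]

theorem extDer_contractLeft (l : h.MJ →ₗ[ℂ] h.MJ) (d : Module.Dual ℂ h.MJ) (ψ : h.Spinor) :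
    h.extDer l (CliffordAlgebra.contractLeft (Q := (0 : QuadraticForm ℂ h.MJ)) d ψ) =
      CliffordAlgebra.contractLeft (Q := (0 : QuadraticForm ℂ h.MJ)) d (h.extDer l ψ) -
      CliffordAlgebra.contractLeft (Q := (0 : QuadraticForm ℂ h.MJ)) (d ∘ₗ l) ψ := by
  induction ψ using h.spinor_induction with
  | smul_one z =>
    simp only [map_smul, CliffordAlgebra.contractLeft_one, extDer_one, smul_zero, map_zero,
      sub_zero]
  | add ψ φ hψ hφ =>
    simp only [map_add, hψ, hφ]
    abel
  | ι_mul X ψ ih =>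
    rw [contractLeft_ι_mul, map_sub, map_smul, extDer_ι_mul, extDer_ι_mul, map_add,
      contractLeft_ι_mul, contractLeft_ι_mul, contractLeft_ι_mul, ih, LinearMap.comp_apply,
      mul_sub]
    abel

theorem algebraMapInv_extDer (l : h.MJ →ₗ[ℂ] h.MJ) (ψ : h.Spinor) :
    ExteriorAlgebra.algebraMapInv (h.extDer l ψ) = (0 : ℂ) := by
  induction ψ using h.spinor_induction with
  | smul_one z => rw [map_smul, extDer_one, smul_zero, map_zero]
  | add ψ φ hψ hφ => rw [map_add, map_add, hψ, hφ, add_zero]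
  | ι_mul X ψ => rw [extDer_ι_mul, map_add, algebraMapInv_ι_mul, algebraMapInv_ι_mul, add_zero]

theorem extDer_annihilation (hl : ∀ X Y, h.g (l X) Y = -h.g X (l Y)) (X : M) (ψ : h.Spinor) :
    h.extDer (h.complexify l hJ) (h.annihilation X ψ) =
      h.annihilation X (h.extDer (h.complexify l hJ) ψ) + h.annihilation (l X) ψ := by
  unfold annihilation
  rw [extDer_contractLeft, herm_comp_complexify h hJ hl, map_neg, LinearMap.neg_apply,
    sub_neg_eq_add]

/-- This lets the zeroth-order terms of the spin connection be moved past `κ`. -/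
theorem extDer_clifford (hl : ∀ X Y, h.g (l X) Y = -h.g X (l Y)) (X : M) (ψ : h.Spinor) :
    h.extDer (h.complexify l hJ) (h.clifford X ψ) =
      h.clifford X (h.extDer (h.complexify l hJ) ψ) + h.clifford (l X) ψ := by
  have extDer_ι : h.extDer (h.complexify l hJ) (ExteriorAlgebra.ι ℂ (h.toMJ X) * ψ) =
      ExteriorAlgebra.ι ℂ (h.toMJ (l X)) * ψ +
        ExteriorAlgebra.ι ℂ (h.toMJ X) * h.extDer (h.complexify l hJ) ψ := h.extDer_ι_mul ..
  rw [clifford_apply, clifford_apply, clifford_apply, map_smul, map_add,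
    extDer_annihilation h hJ hl, extDer_ι, ← smul_add]
  congr 1
  abel

theorem spinInner_extDer_left (hl : ∀ X Y, h.g (l X) Y = -h.g X (l Y)) (ψ φ : h.Spinor) :
    h.spinInner (h.extDer (h.complexify l hJ) ψ) φ =
      -h.spinInner ψ (h.extDer (h.complexify l hJ) φ) := by
  induction φ using h.spinor_induction generalizing ψ with
  | smul_one z =>
    rw [map_smul, extDer_one, smul_zero, spinInner_zero_right, spinInner_smul_right,
      spinInner_one, algebraMapInv_extDer, map_zero, mul_zero, neg_zero]
  | add φ φ' hφ hφ' => rw [spinInner_add_right, hφ, hφ', map_add, spinInner_add_right, neg_add]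
  | ι_mul Y φ ih =>
    have inner_ι_l : h.spinInner ψ (ExteriorAlgebra.ι ℂ (h.complexify l hJ (h.toMJ Y)) * φ) =
        h.spinInner (h.annihilation (l Y) ψ) φ := h.spinInner_ι_mul ..
    rw [spinInner_ι_mul, ← sub_eq_of_eq_add (extDer_annihilation h hJ hl Y ψ),
      spinInner_sub_left, ih, extDer_ι_mul, spinInner_add_right, spinInner_ι_mul, inner_ι_l]
    ring

end Derivation

end HermSpace

section ParametricIntegral

variable {E : Type*} [NormedAddCommGroup E] [NormedSpace ℝ E]
  {H : Type*} [TopologicalSpace H] {I : ModelWithCorners ℝ E H}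
  {G : Type*} [TopologicalSpace G] [ChartedSpace H G]
  {F : Type*} [NormedAddCommGroup F] [NormedSpace ℝ F]
  {f : F → G → ℝ} {U : Set F}

theorem contDiffOn_left (hf : ContMDiffOn (𝓘(ℝ, F).prod I) 𝓘(ℝ, ℝ) ∞ (Function.uncurry f)
    (U ×ˢ Set.univ)) (y : G) : ContDiffOn ℝ ∞ (fun u => f u y) U :=
  (hf.comp (contMDiffOn_id.prodMk contMDiffOn_const) fun _ hu => ⟨hu, trivial⟩).contDiffOn

theorem contMDiffOn_fderiv_left [IsManifold I ∞ G] (hU : IsOpen U)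
    (hf : ContMDiffOn (𝓘(ℝ, F).prod I) 𝓘(ℝ, ℝ) ∞ (Function.uncurry f) (U ×ˢ Set.univ)) :
    ContMDiffOn (𝓘(ℝ, F).prod I) 𝓘(ℝ, F →L[ℝ] ℝ) ∞
      (fun p : F × G => fderiv ℝ (fun u => f u p.2) p.1) (U ×ˢ Set.univ) := by
  rintro ⟨u, y⟩ ⟨hu, -⟩
  have hf_at : ContMDiffAt (𝓘(ℝ, F).prod I) 𝓘(ℝ, ℝ) ∞ (Function.uncurry f) (u, y) :=
    hf.contMDiffAt ((hU.prod isOpen_univ).mem_nhds ⟨hu, trivial⟩)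
  have hswap : ContMDiffAt ((𝓘(ℝ, F).prod I).prod 𝓘(ℝ, F)) (𝓘(ℝ, F).prod I) ∞
      (fun q : (F × G) × F => (q.2, q.1.2)) ((u, y), u) :=
    contMDiffAt_snd.prodMk contMDiffAt_fst.snd
  have hmfderiv := ContMDiffAt.mfderiv (I := 𝓘(ℝ, F)) (I' := 𝓘(ℝ, ℝ)) (J := 𝓘(ℝ, F).prod I)
    (m := ∞) (n := ∞) (fun (p : F × G) (u' : F) => f u' p.2) (fun p => p.1)
    (ContMDiffAt.comp ((u, y), u) (g := Function.uncurry f) hf_at hswap) contMDiffAt_fst (by simp)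
  simp only [mfderiv_eq_fderiv] at hmfderiv
  have hcoord := inTangentCoordinates_model_space (I := 𝓘(ℝ, F)) (I' := 𝓘(ℝ, ℝ))
    (fun p : F × G => p.1) (fun p => f p.1 p.2)
    (fun p : F × G => fderiv ℝ (fun u => f u p.2) p.1) (u, y)
  exact (hcoord ▸ hmfderiv).contMDiffWithinAt

variable [IsManifold I ∞ G] {A : Type*} [TopologicalSpace A] {j : A → G} (hj : Continuous j)
  {c : A → ℝ} (hc : Continuous c)

include hj hc

theorem continuousOn_smul_fderiv_left (hU : IsOpen U)
    (hf : ContMDiffOn (𝓘(ℝ, F).prod I) 𝓘(ℝ, ℝ) ∞ (Function.uncurry f) (U ×ˢ Set.univ)) :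
    ContinuousOn (fun p : F × A => c p.2 • fderiv ℝ (fun u => f u (j p.2)) p.1)
      (U ×ˢ Set.univ) :=
  (hc.comp continuous_snd).continuousOn.smul <|
    (contMDiffOn_fderiv_left hU hf).continuousOn.comp (f := fun p : F × A => (p.1, j p.2))
      (by fun_prop) fun _ hp => ⟨hp.1, trivial⟩

variable [CompactSpace A] [MeasurableSpace A] [BorelSpace A] (ν : Measure A) [IsFiniteMeasure ν]

theorem integrable_smul_fderiv_left (hU : IsOpen U)
    (hf : ContMDiffOn (𝓘(ℝ, F).prod I) 𝓘(ℝ, ℝ) ∞ (Function.uncurry f) (U ×ˢ Set.univ))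
    {u : F} (hu : u ∈ U) : Integrable (fun a => c a • fderiv ℝ (fun u => f u (j a)) u) ν :=
  ((continuousOn_smul_fderiv_left hj hc hU hf).comp_continuous (f := fun a => (u, a))
    (by fun_prop) fun _ => ⟨hu, trivial⟩).integrable_of_hasCompactSupport
    (HasCompactSupport.of_compactSpace _)

theorem hasFDerivAt_parametric_integral [FiniteDimensional ℝ F] (hU : IsOpen U)
    (hf : ContMDiffOn (𝓘(ℝ, F).prod I) 𝓘(ℝ, ℝ) ∞ (Function.uncurry f) (U ×ˢ Set.univ))
    {u : F} (hu : u ∈ U) : HasFDerivAt (fun u => ∫ a, c a * f u (j a) ∂ν)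
      (∫ a, c a • fderiv ℝ (fun u => f u (j a)) u ∂ν) u := by
  have : ProperSpace F := FiniteDimensional.proper ℝ F
  have hint : ∀ u ∈ U, Integrable (fun a => c a * f u (j a)) ν := fun u hu =>
    (hc.mul (hf.continuousOn.comp_continuous (f := fun a => (u, j a)) (by fun_prop)
      fun _ => ⟨hu, trivial⟩)).integrable_of_hasCompactSupport (HasCompactSupport.of_compactSpace _)
  obtain ⟨ε, hε, hεU⟩ := Metric.nhds_basis_closedBall.mem_iff.1 (hU.mem_nhds hu)
  obtain ⟨B, hB⟩ := ((isCompact_closedBall u ε).prod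
    (isCompact_univ (X := A))).exists_bound_of_continuousOn
    ((continuousOn_smul_fderiv_left hj hc hU hf).mono (Set.prod_mono_left hεU))
  refine hasFDerivAt_integral_of_dominated_of_fderiv_le (F := fun u a => c a * f u (j a))
    (F' := fun u a => c a • fderiv ℝ (fun u => f u (j a)) u) (bound := fun _ => B)
    (Metric.closedBall_mem_nhds u hε) ?_ (hint u hu)
    (integrable_smul_fderiv_left hj hc ν hU hf hu).1
    (.of_forall fun a x hx => hB (x, a) ⟨hx, trivial⟩) (integrable_const B)
    (.of_forall fun a x hx => ?_)
  · filter_upwards [hU.mem_nhds hu] with x hx using (hint x hx).1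
  · have hfa := (contDiffOn_left hf (j a)).contDiffAt (hU.mem_nhds (hεU hx))
    exact (hfa.differentiableAt (by simp)).hasFDerivAt.const_smul (c a)

theorem contDiffOn_parametric_integral [FiniteDimensional ℝ F] (hU : IsOpen U)
    (hf : ContMDiffOn (𝓘(ℝ, F).prod I) 𝓘(ℝ, ℝ) ∞ (Function.uncurry f) (U ×ˢ Set.univ)) :
    ContDiffOn ℝ ∞ (fun u => ∫ a, c a * f u (j a) ∂ν) U := by
  refine contDiffOn_infty.2 fun n => ?_
  induction n generalizing f with
  | zero =>
    exact contDiffOn_zero.2 fun u hu =>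
      (hasFDerivAt_parametric_integral hj hc ν hU hf hu).continuousAt.continuousWithinAt
  | succ n ih =>
    refine contDiffOn_succ_of_fderiv_apply (fun u hu => (hasFDerivAt_parametric_integral
      hj hc ν hU hf hu).differentiableAt.differentiableWithinAt)
      (fun h => (WithTop.natCast_ne_top n h).elim) fun v => ?_
    refine (ih (f := fun u y => fderiv ℝ (fun u => f u y) u v)
      ((contMDiffOn_fderiv_left hU hf).clm_apply contMDiffOn_const)).congr fun u hu => ?_
    rw [fderivWithin_of_isOpen hU hu, (hasFDerivAt_parametric_integral hj hc ν hU hf hu).fderiv,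
      ContinuousLinearMap.integral_apply (integrable_smul_fderiv_left hj hc ν hU hf hu)]
    rfl

end ParametricIntegral

section ChainRule

variable {𝕜 : Type*} [NontriviallyNormedField 𝕜]
  {E : Type*} [NormedAddCommGroup E] [NormedSpace 𝕜 E] {H : Type*} [TopologicalSpace H]
  {I : ModelWithCorners 𝕜 E H} {M : Type*} [TopologicalSpace M] [ChartedSpace H M]
  {E' : Type*} [NormedAddCommGroup E'] [NormedSpace 𝕜 E'] {H' : Type*} [TopologicalSpace H']
  {I' : ModelWithCorners 𝕜 E' H'} {M' : Type*} [TopologicalSpace M'] [ChartedSpace H' M']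
  {E'' : Type*} [NormedAddCommGroup E''] [NormedSpace 𝕜 E''] {H'' : Type*} [TopologicalSpace H'']
  {I'' : ModelWithCorners 𝕜 E'' H''} {M'' : Type*} [TopologicalSpace M''] [ChartedSpace H'' M'']

/-- Stated on the model spaces because the tangent spaces at `f x` and `y` are only propositionally
equal. -/
theorem mfderiv_comp_apply_eq {g : M' → M''} {f : M → M'} {x : M} {y : M'}
    (hg : MDifferentiableAt I' I'' g y) (hf : MDifferentiableAt I I' f x) (hy : f x = y) (v : E) :
    (mfderiv I I'' (g ∘ f) x : E →L[𝕜] E'') v =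
      (mfderiv I' I'' g y : E' →L[𝕜] E'') ((mfderiv I I' f x : E →L[𝕜] E') v) := by
  subst hy
  exact DFunLike.congr_fun (mfderiv_comp x hg hf) v

end ChainRule

section DirectionalDerivative

variable {E : Type*} [NormedAddCommGroup E] [NormedSpace ℝ E]
  {H : Type*} [TopologicalSpace H] (I : ModelWithCorners ℝ E H)
  {G : Type*} [TopologicalSpace G] [ChartedSpace H G] [Group G]

variable {I}

theorem dirDeriv_add_vec (f : G → ℝ) (x : G) (v w : GroupLieAlgebra I G) :
    dirDeriv I f x (v + w) = dirDeriv I f x v + dirDeriv I f x w := by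
  unfold dirDeriv
  rw [mulInvariantVectorField_add]
  exact map_add _ _ _

theorem dirDeriv_smul_vec (f : G → ℝ) (x : G) (c : ℝ) (v : GroupLieAlgebra I G) :
    dirDeriv I f x (c • v) = c * dirDeriv I f x v := by
  unfold dirDeriv
  rw [mulInvariantVectorField_smul]
  exact map_smul _ _ _

variable [LieGroup I ∞ G]

variable (I) in
theorem mdifferentiableAt_mul_left (x z : G) : MDifferentiableAt I I (x * ·) z :=
  (contMDiff_mul_left (I := I) (n := ∞) (a := x)).mdifferentiableAt (by simp)

variable {f g : G → ℝ}

theorem dirDeriv_eq_mfderiv_one (hf : ContMDiff I 𝓘(ℝ, ℝ) ∞ f) (x : G) (v : GroupLieAlgebra I G) :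
    dirDeriv I f x v = (mfderiv I 𝓘(ℝ, ℝ) (fun z => f (x * z)) (1 : G) : E →L[ℝ] ℝ) v :=
  (mfderiv_comp_apply_eq (hf.mdifferentiableAt (by simp)) (mdifferentiableAt_mul_left I x 1)
    (mul_one x) v).symm

theorem dirDeriv_mul_left (hf : ContMDiff I 𝓘(ℝ, ℝ) ∞ f) (a x : G) (v : GroupLieAlgebra I G) :
    dirDeriv I (fun y => f (a * y)) x v = dirDeriv I f (a * x) v := by
  rw [dirDeriv_eq_mfderiv_one hf,
    dirDeriv_eq_mfderiv_one (f := fun y => f (a * y)) (hf.comp contMDiff_mul_left)]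
  exact congrArg (fun F : G → ℝ => (mfderiv I 𝓘(ℝ, ℝ) F (1 : G) : E →L[ℝ] ℝ) v)
    (funext fun z => by rw [mul_assoc])

theorem dirDeriv_mul_right [FiniteDimensional ℝ E] (hf : ContMDiff I 𝓘(ℝ, ℝ) ∞ f) (s x : G)
    (v : GroupLieAlgebra I G) :
    dirDeriv I (fun y => f (y * s)) x v = dirDeriv I f (x * s) (Ad I s⁻¹ v) := by
  have hcomp : (fun z => f (x * z * s)) = (fun z => f (x * s * z)) ∘ conj s⁻¹ := by
    ext z
    simp [conj, mul_assoc]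
  have hleft : ContMDiff I 𝓘(ℝ, ℝ) ∞ fun z => f (x * s * z) := hf.comp contMDiff_mul_left
  rw [dirDeriv_eq_mfderiv_one hf,
    dirDeriv_eq_mfderiv_one (f := fun y => f (y * s)) (hf.comp contMDiff_mul_right), hcomp]
  exact mfderiv_comp_apply_eq (hleft.mdifferentiableAt (by simp)) (mdiff_conj I s⁻¹ 1)
    (conj_one _) v

theorem contMDiffOn_mul_chart (hf : ContMDiff I 𝓘(ℝ, ℝ) ∞ f) (x : G) :
    ContMDiffOn (𝓘(ℝ, E).prod I) 𝓘(ℝ, ℝ) ∞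
      (Function.uncurry fun (u : E) (y : G) => f (y * (extChartAt I x).symm u))
      ((extChartAt I x).target ×ˢ Set.univ) :=
  hf.comp_contMDiffOn <| contMDiffOn_snd.mul <|
    (contMDiffOn_extChartAt_symm x).comp contMDiffOn_fst fun _ hp => hp.1

theorem contMDiffOn_chart_mul (hf : ContMDiff I 𝓘(ℝ, ℝ) ∞ f) (x : G) :
    ContMDiffOn (𝓘(ℝ, E).prod I) 𝓘(ℝ, ℝ) ∞
      (Function.uncurry fun (u : E) (y : G) => f ((extChartAt I x).symm u * y))
      ((extChartAt I x).target ×ˢ Set.univ) :=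
  hf.comp_contMDiffOn <| ((contMDiffOn_extChartAt_symm x).comp contMDiffOn_fst
    fun _ hp => hp.1).mul contMDiffOn_snd

variable [I.Boundaryless]

theorem contMDiff_convolution [FiniteDimensional ℝ E] {A : Type*} [TopologicalSpace A]
    {j : A → G} (hj : Continuous j) {c : A → ℝ} (hc : Continuous c) [CompactSpace A]
    [MeasurableSpace A] [BorelSpace A] (ν : Measure A)
    [IsFiniteMeasure ν] (hf : ContMDiff I 𝓘(ℝ, ℝ) ∞ f) :
    ContMDiff I 𝓘(ℝ, ℝ) ∞ fun x => ∫ a, c a * f (x * j a) ∂ν := fun x => by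
  have hchart := (contDiffOn_parametric_integral hj hc ν (isOpen_extChartAt_target x)
    (contMDiffOn_chart_mul hf x)).contDiffAt (extChartAt_target_mem_nhds x)
  refine (hchart.contMDiffAt.comp x contMDiffAt_extChartAt).congr_of_eventuallyEq ?_
  filter_upwards [extChartAt_source_mem_nhds (I := I) x] with y hy
  simp only [Function.comp_apply, (extChartAt I x).left_inv hy]

variable (I) in
/-- The coordinates of a Lie algebra element in the chart at the identity. -/
def chartVec (v : GroupLieAlgebra I G) : E :=
  (mfderiv I 𝓘(ℝ, E) (extChartAt I (1 : G)) (1 : G) : E →L[ℝ] E) v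

theorem contDiffAt_mul_chart (hf : ContMDiff I 𝓘(ℝ, ℝ) ∞ f) (x : G) :
    ContDiffAt ℝ ∞ (fun u : E => f (x * (extChartAt I (1 : G)).symm u)) (extChartAt I (1 : G) 1) :=
  (contDiffOn_left (contMDiffOn_mul_chart hf 1) x).contDiffAt (extChartAt_target_mem_nhds 1)

theorem dirDeriv_eq_fderiv (hf : ContMDiff I 𝓘(ℝ, ℝ) ∞ f) (x : G) (v : GroupLieAlgebra I G) :
    dirDeriv I f x v =
      fderiv ℝ (fun u : E => f (x * (extChartAt I (1 : G)).symm u)) (extChartAt I (1 : G) 1)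
        (chartVec I v) := by
  set φ := extChartAt I (1 : G)
  have hlocal : (fun u : E => f (x * φ.symm u)) ∘ φ =ᶠ[nhds 1] fun z => f (x * z) := by
    filter_upwards [extChartAt_source_mem_nhds (I := I) (1 : G)] with z hz
    simp only [Function.comp_apply, φ.left_inv hz]
  rw [dirDeriv_eq_mfderiv_one hf, ← hlocal.mfderiv_eq, ← mfderiv_eq_fderiv]
  exact mfderiv_comp_apply_eq ((contDiffAt_mul_chart hf x).contMDiffAt.mdifferentiableAt (by simp))
    ((contMDiffAt_extChartAt (n := ∞)).mdifferentiableAt (by simp)) rfl v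

theorem contMDiff_dirDeriv (hf : ContMDiff I 𝓘(ℝ, ℝ) ∞ f) (v : GroupLieAlgebra I G) :
    ContMDiff I 𝓘(ℝ, ℝ) ∞ fun x => dirDeriv I f x v := by
  simp only [dirDeriv_eq_fderiv hf]
  intro x
  have hfderiv := (contMDiffOn_fderiv_left (isOpen_extChartAt_target (1 : G))
    (contMDiffOn_mul_chart hf 1)).contMDiffAt (x := (extChartAt I (1 : G) 1, x))
    (((isOpen_extChartAt_target (1 : G)).prod isOpen_univ).mem_nhds
      ⟨mem_extChartAt_target (1 : G), trivial⟩)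
  exact (ContMDiffAt.comp x (f := fun y : G => (extChartAt I (1 : G) 1, y)) hfderiv
    (contMDiffAt_const.prodMk contMDiffAt_id)).clm_apply contMDiffAt_const

theorem dirDeriv_add (hf : ContMDiff I 𝓘(ℝ, ℝ) ∞ f) (hg : ContMDiff I 𝓘(ℝ, ℝ) ∞ g)
    (x : G) (v : GroupLieAlgebra I G) :
    dirDeriv I (fun y => f y + g y) x v = dirDeriv I f x v + dirDeriv I g x v := by
  rw [dirDeriv_eq_fderiv hf, dirDeriv_eq_fderiv hg,
    dirDeriv_eq_fderiv (f := fun y => f y + g y) (hf.add hg),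
    fderiv_fun_add ((contDiffAt_mul_chart hf x).differentiableAt (by simp))
      ((contDiffAt_mul_chart hg x).differentiableAt (by simp))]
  rfl

theorem dirDeriv_mul (hf : ContMDiff I 𝓘(ℝ, ℝ) ∞ f) (hg : ContMDiff I 𝓘(ℝ, ℝ) ∞ g)
    (x : G) (v : GroupLieAlgebra I G) :
    dirDeriv I (fun y => f y * g y) x v = dirDeriv I f x v * g x + f x * dirDeriv I g x v := by
  rw [dirDeriv_eq_fderiv hf, dirDeriv_eq_fderiv hg,
    dirDeriv_eq_fderiv (f := fun y => f y * g y) (hf.mul hg),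
    fderiv_fun_mul ((contDiffAt_mul_chart hf x).differentiableAt (by simp))
      ((contDiffAt_mul_chart hg x).differentiableAt (by simp))]
  simp
  ring

theorem dirDeriv_const (c : ℝ) (x : G) (v : GroupLieAlgebra I G) :
    dirDeriv I (fun _ => c) x v = 0 := by
  rw [dirDeriv_eq_fderiv contMDiff_const]
  simp

theorem dirDeriv_const_mul (hf : ContMDiff I 𝓘(ℝ, ℝ) ∞ f) (c : ℝ) (x : G)
    (v : GroupLieAlgebra I G) : dirDeriv I (fun y => c * f y) x v = c * dirDeriv I f x v := by
  rw [dirDeriv_mul contMDiff_const hf, dirDeriv_const, zero_mul, zero_add]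

theorem dirDeriv_sum {ι : Type*} (s : Finset ι) {f : ι → G → ℝ}
    (hf : ∀ i, ContMDiff I 𝓘(ℝ, ℝ) ∞ (f i)) (x : G) (v : GroupLieAlgebra I G) :
    dirDeriv I (fun y => ∑ i ∈ s, f i y) x v = ∑ i ∈ s, dirDeriv I (f i) x v := by
  classical
  induction s using Finset.induction_on with
  | empty => simpa using dirDeriv_const 0 x v
  | insert i s hi ih =>
    simp only [Finset.sum_insert hi]
    rw [dirDeriv_add (hf i) (contMDiff_finsetSum fun i _ => hf i), ih]

/-- Right invariance makes `u ↦ ∫ f (x φ⁻¹(u))` constant; now differentiate at the identity. -/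
theorem integral_dirDeriv [FiniteDimensional ℝ E] [CompactSpace G] [MeasurableSpace G]
    [BorelSpace G] (μ : Measure G) [μ.IsHaarMeasure]
    (hf : ContMDiff I 𝓘(ℝ, ℝ) ∞ f) (v : GroupLieAlgebra I G) :
    ∫ x, dirDeriv I f x v ∂μ = 0 := by
  have : IsTopologicalGroup G := topologicalGroup_of_lieGroup I ∞
  have : μ.IsMulRightInvariant := isMulRightInvariant_of_compactSpace μ
  have hopen := isOpen_extChartAt_target (I := I) (1 : G)
  have hone := mem_extChartAt_target (I := I) (1 : G)
  have hint := integrable_smul_fderiv_left continuous_id (continuous_const (y := (1 : ℝ))) μ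
    hopen (contMDiffOn_mul_chart hf 1) hone
  have hderiv := hasFDerivAt_parametric_integral continuous_id (continuous_const (y := (1 : ℝ))) μ
    hopen (contMDiffOn_mul_chart hf 1) hone
  simp only [one_mul, one_smul, id_eq, integral_mul_right_eq_self f] at hint hderiv
  have hzero := (hasFDerivAt_const (∫ x, f x ∂μ) (extChartAt I (1 : G) 1)).unique hderiv
  simp only [dirDeriv_eq_fderiv hf]
  rw [← ContinuousLinearMap.integral_apply hint, ← hzero]
  rfl

end DirectionalDerivative

section VectorDerivative

variable {E : Type*} [NormedAddCommGroup E] [NormedSpace ℝ E]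
  {H : Type*} [TopologicalSpace H] {I : ModelWithCorners ℝ E H}
  {G : Type*} [TopologicalSpace G] [ChartedSpace H G]
  {F : Type*} [AddCommGroup F] [Module ℝ F]
  {F' : Type*} [AddCommGroup F'] [Module ℝ F']
  {F'' : Type*} [AddCommGroup F''] [Module ℝ F'']

namespace SmoothTo

theorem of_contMDiff {f : G → ℝ} (hf : ContMDiff I 𝓘(ℝ, ℝ) ∞ f) : SmoothTo I f :=
  fun l => l.toContinuousLinearMap.contMDiff.comp hf

theorem contMDiff {f : G → ℝ} (hf : SmoothTo I f) : ContMDiff I 𝓘(ℝ, ℝ) ∞ f :=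
  hf LinearMap.id

theorem comp_linear {f : G → F} (hf : SmoothTo I f) (l : F →ₗ[ℝ] F') :
    SmoothTo I fun x => l (f x) := fun k => hf (k ∘ₗ l)

theorem add {f g : G → F} (hf : SmoothTo I f) (hg : SmoothTo I g) :
    SmoothTo I fun x => f x + g x := fun l => by
  simp only [map_add]
  exact (hf l).add (hg l)

theorem sum {ι : Type*} (s : Finset ι) {f : ι → G → F} (hf : ∀ i, SmoothTo I (f i)) :
    SmoothTo I fun x => ∑ i ∈ s, f i x := fun l => by
  simp only [map_sum]
  exact contMDiff_finsetSum fun i _ => hf i l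

end SmoothTo

variable [Module.Finite ℝ F]

theorem apply_eq_sum_coord (l : F →ₗ[ℝ] F') (a : F) :
    l a = ∑ i, (Module.finBasis ℝ F).coord i a • l (Module.finBasis ℝ F i) := by
  conv_lhs => rw [← (Module.finBasis ℝ F).sum_repr a, map_sum]
  simp only [map_smul, Module.Basis.coord_apply]

theorem eq_of_forall_linear {a b : F} (h : ∀ l : F →ₗ[ℝ] ℝ, l a = l b) : a = b :=
  (Module.finBasis ℝ F).ext_elem fun i => h ((Module.finBasis ℝ F).coord i)

theorem SmoothTo.bilin {f : G → F} {g : G → F'} (hf : SmoothTo I f) (hg : SmoothTo I g)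
    (β : F →ₗ[ℝ] F' →ₗ[ℝ] F'') : SmoothTo I fun x => β (f x) (g x) := by
  intro l
  have hcoord : (fun x => l (β (f x) (g x))) = fun x => ∑ i,
      (Module.finBasis ℝ F).coord i (f x) * (l ∘ₗ β (Module.finBasis ℝ F i)) (g x) :=
    funext fun x => apply_eq_sum_coord (l ∘ₗ β.flip (g x)) (f x)
  rw [hcoord]
  exact contMDiff_finsetSum fun i _ => (hf _).mul (hg _)

variable [Module.Finite ℝ F'] [Module.Finite ℝ F''] [Group G] [LieGroup I ∞ G]

variable (I) in
/-- The derivative of `f` at `x` as a linear map on the Lie algebra. -/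
def vecDerivLin (f : G → F) (x : G) : GroupLieAlgebra I G →ₗ[ℝ] F where
  toFun := vecDeriv I f x
  map_add' v w := by simp [vecDeriv, dirDeriv_add_vec, add_smul, Finset.sum_add_distrib]
  map_smul' c v := by simp [vecDeriv, dirDeriv_smul_vec, mul_smul, Finset.smul_sum]

theorem vecDeriv_mul_left {f : G → F} (hf : SmoothTo I f) (a x : G) (v : GroupLieAlgebra I G) :
    vecDeriv I (fun y => f (a * y)) x v = vecDeriv I f (a * x) v :=
  Finset.sum_congr rfl fun i _ => by rw [← dirDeriv_mul_left (hf _)]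

theorem vecDeriv_mul_right [FiniteDimensional ℝ E] {f : G → F} (hf : SmoothTo I f) (s x : G)
    (v : GroupLieAlgebra I G) :
    vecDeriv I (fun y => f (y * s)) x v = vecDeriv I f (x * s) (Ad I s⁻¹ v) :=
  Finset.sum_congr rfl fun i _ => by rw [← dirDeriv_mul_right (hf _)]

variable [I.Boundaryless]

theorem apply_vecDeriv {f : G → F} (hf : SmoothTo I f) (l : F →ₗ[ℝ] ℝ) (x : G)
    (v : GroupLieAlgebra I G) : l (vecDeriv I f x v) = dirDeriv I (fun y => l (f y)) x v := by
  have hcoord : (fun x => l (f x)) = fun x => ∑ i, l (Module.finBasis ℝ F i) *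
      (Module.finBasis ℝ F).coord i (f x) := by
    ext x
    simpa only [smul_eq_mul, mul_comm] using apply_eq_sum_coord l (f x)
  rw [hcoord, dirDeriv_sum (f := fun i y => l (Module.finBasis ℝ F i) *
    (Module.finBasis ℝ F).coord i (f y)) _ fun i => contMDiff_const.mul (hf _)]
  simp only [dirDeriv_const_mul (hf _), vecDeriv, map_sum, map_smul, smul_eq_mul]
  exact Finset.sum_congr rfl fun i _ => mul_comm _ _

theorem map_vecDeriv {f : G → F} (hf : SmoothTo I f) (l : F →ₗ[ℝ] F') (x : G)
    (v : GroupLieAlgebra I G) : l (vecDeriv I f x v) = vecDeriv I (fun y => l (f y)) x v :=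
  eq_of_forall_linear fun k => by
    rw [apply_vecDeriv (hf.comp_linear l), ← LinearMap.comp_apply, apply_vecDeriv hf]
    rfl

theorem dirDeriv_bilin {f : G → F} {g : G → F'} (hf : SmoothTo I f) (hg : SmoothTo I g)
    (β : F →ₗ[ℝ] F' →ₗ[ℝ] ℝ) (x : G) (v : GroupLieAlgebra I G) :
    dirDeriv I (fun y => β (f y) (g y)) x v =
      β (vecDeriv I f x v) (g x) + β (f x) (vecDeriv I g x v) := by
  have hcoord : (fun x => β (f x) (g x)) = fun x => ∑ i, (Module.finBasis ℝ F).coord i (f x) *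
      β (Module.finBasis ℝ F i) (g x) :=
    funext fun x => apply_eq_sum_coord (β.flip (g x)) (f x)
  rw [hcoord, dirDeriv_sum (f := fun i y => (Module.finBasis ℝ F).coord i (f y) *
    β (Module.finBasis ℝ F i) (g y)) _ fun i => (hf _).mul (hg _)]
  simp only [dirDeriv_mul (hf _) (hg _), Finset.sum_add_distrib]
  congr 1
  · simp [vecDeriv]
  · simp only [← apply_vecDeriv hg]
    exact (apply_eq_sum_coord (β.flip (vecDeriv I g x v)) (f x)).symm

theorem vecDeriv_bilin {f : G → F} {g : G → F'} (hf : SmoothTo I f) (hg : SmoothTo I g)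
    (β : F →ₗ[ℝ] F' →ₗ[ℝ] F'') (x : G) (v : GroupLieAlgebra I G) :
    vecDeriv I (fun y => β (f y) (g y)) x v =
      β (vecDeriv I f x v) (g x) + β (f x) (vecDeriv I g x v) :=
  eq_of_forall_linear fun k => by
    rw [apply_vecDeriv (hf.bilin hg β), map_add]
    exact dirDeriv_bilin hf hg (β.compr₂ k) x v

theorem vecDeriv_add {f g : G → F} (hf : SmoothTo I f) (hg : SmoothTo I g) (x : G)
    (v : GroupLieAlgebra I G) :
    vecDeriv I (fun y => f y + g y) x v = vecDeriv I f x v + vecDeriv I g x v :=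
  eq_of_forall_linear fun k => by
    simp only [apply_vecDeriv (hf.add hg), map_add, dirDeriv_add (hf k) (hg k),
      apply_vecDeriv hf, apply_vecDeriv hg]

theorem SmoothTo.vecDeriv {f : G → F} (hf : SmoothTo I f) (v : GroupLieAlgebra I G) :
    SmoothTo I fun x => vecDeriv I f x v := fun l => by
  simp only [apply_vecDeriv hf]
  exact contMDiff_dirDeriv (hf l) v

end VectorDerivative

section LocalProduct

open Filter Topology ContinuousLinearMap

variable {E : Type*} [NormedAddCommGroup E] [NormedSpace ℝ E] {m : E × E → E} {u₀ : E}

theorem fderiv_apply_inr_of_left_unit (hm : DifferentiableAt ℝ m (u₀, u₀))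
    (hl : ∀ᶠ v in 𝓝 u₀, m (u₀, v) = v) (y : E) : fderiv ℝ m (u₀, u₀) (0, y) = y := by
  have hd := hm.hasFDerivAt.comp u₀ (hasFDerivAt_prodMk_right u₀ u₀)
  have hid := hd.congr_of_eventuallyEq (hl.mono fun _ h => h.symm)
  exact DFunLike.congr_fun (hid.unique (hasFDerivAt_id u₀)) y

theorem fderiv_apply_inl_of_right_unit (hm : DifferentiableAt ℝ m (u₀, u₀))
    (hr : ∀ᶠ u in 𝓝 u₀, m (u, u₀) = u) (y : E) : fderiv ℝ m (u₀, u₀) (y, 0) = y := by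
  have hd := hm.hasFDerivAt.comp (f := fun u : E => (u, u₀)) u₀ (hasFDerivAt_prodMk_left u₀ u₀)
  have hid := hd.congr_of_eventuallyEq (hr.mono fun _ h => h.symm)
  exact DFunLike.congr_fun (hid.unique (hasFDerivAt_id u₀)) y

theorem hasFDerivAt_fderiv (hm : ContDiffAt ℝ 2 m (u₀, u₀)) :
    HasFDerivAt (fderiv ℝ m) (fderiv ℝ (fderiv ℝ m) (u₀, u₀)) (u₀, u₀) :=
  ((hm.fderiv_right (m := 1) (by norm_num)).differentiableAt (by norm_num)).hasFDerivAt

theorem hasFDerivAt_fderiv_apply_inr (hm : ContDiffAt ℝ 2 m (u₀, u₀)) (y : E) :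
    HasFDerivAt (fun u => fderiv ℝ m (u, u₀) (0, y))
      ((fderiv ℝ (fderiv ℝ m) (u₀, u₀) ∘L inl ℝ E E).flip (0, y)) u₀ := by
  simpa using ((hasFDerivAt_fderiv hm).comp (f := fun u : E => (u, u₀)) u₀
    (hasFDerivAt_prodMk_left u₀ u₀)).clm_apply (hasFDerivAt_const ((0 : E), y) u₀)

theorem hasFDerivAt_fderiv_apply_inl (hm : ContDiffAt ℝ 2 m (u₀, u₀)) {a : E → E}
    (ha : DifferentiableAt ℝ a u₀) :
    HasFDerivAt (fun u => fderiv ℝ m (u₀, u) (a u, 0))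
      (fderiv ℝ m (u₀, u₀) ∘L inl ℝ E E ∘L fderiv ℝ a u₀ +
        (fderiv ℝ (fderiv ℝ m) (u₀, u₀) ∘L inr ℝ E E).flip (a u₀, 0)) u₀ :=
  ((hasFDerivAt_fderiv hm).comp u₀ (hasFDerivAt_prodMk_right u₀ u₀)).clm_apply
    ((inl ℝ E E).hasFDerivAt.comp u₀ ha.hasFDerivAt)

/-- Here `m` is the product of a Lie group in a chart around the unit `u₀`, `V` and `W` are
left-invariant vector fields, and `a u` is the value at `w` of the adjoint action of `u`. Both sides
are differences of mixed second derivatives of `m`. -/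
theorem lieBracket_of_local_product (hm : ContDiffAt ℝ 2 m (u₀, u₀))
    (hl : ∀ᶠ v in 𝓝 u₀, m (u₀, v) = v) (hr : ∀ᶠ u in 𝓝 u₀, m (u, u₀) = u) {x w : E} {a : E → E}
    (ha : DifferentiableAt ℝ a u₀)
    (hadj : ∀ᶠ u in 𝓝 u₀, fderiv ℝ m (u, u₀) (0, w) = fderiv ℝ m (u₀, u) (a u, 0)) {V W : E → E}
    (hV : ∀ᶠ u in 𝓝 u₀, V u = fderiv ℝ m (u, u₀) (0, x))
    (hW : ∀ᶠ u in 𝓝 u₀, W u = fderiv ℝ m (u, u₀) (0, w)) :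
    VectorField.lieBracket ℝ V W u₀ = fderiv ℝ a u₀ x := by
  have hinr := fderiv_apply_inr_of_left_unit (hm.differentiableAt (by norm_num)) hl
  have hinl := fderiv_apply_inl_of_right_unit (hm.differentiableAt (by norm_num)) hr
  have hsymm : fderiv ℝ (fderiv ℝ m) (u₀, u₀) (w, 0) (0, x) =
      fderiv ℝ (fderiv ℝ m) (u₀, u₀) (0, x) (w, 0) :=
    hm.isSymmSndFDerivAt (by rw [minSmoothness_of_isRCLikeNormedField]) _ _
  have ha₀ : a u₀ = w := by
    have := hadj.self_of_nhds
    rwa [hinr, hinl, eq_comm] at this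
  have hDV := (hasFDerivAt_fderiv_apply_inr hm x).congr_of_eventuallyEq hV
  have hDW := (hasFDerivAt_fderiv_apply_inr hm w).congr_of_eventuallyEq hW
  have hmixed := DFunLike.congr_fun ((hasFDerivAt_fderiv_apply_inr hm w).unique
    ((hasFDerivAt_fderiv_apply_inl hm ha).congr_of_eventuallyEq hadj)) x
  simp only [flip_apply, comp_apply, add_apply, inl_apply, inr_apply, hinl, ha₀] at hmixed
  rw [VectorField.lieBracket_eq]
  simp only [hDV.fderiv, hDW.fderiv, hV.self_of_nhds, hW.self_of_nhds, hinr, flip_apply,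
    comp_apply, inl_apply, hmixed, hsymm]
  abel

end LocalProduct

section AdjointDerivative

open Filter Topology

variable {E : Type*} [NormedAddCommGroup E] [NormedSpace ℝ E]
  {H : Type*} [TopologicalSpace H] (I : ModelWithCorners ℝ E H)
  {G : Type*} [TopologicalSpace G] [ChartedSpace H G] [Group G]

variable (G) in
/-- The product of `G` in the chart at the identity. -/
def chartMul (p : E × E) : E :=
  extChartAt I (1 : G) ((extChartAt I (1 : G)).symm p.1 * (extChartAt I (1 : G)).symm p.2)

theorem chartMul_left_unit {u : E} (hu : u ∈ (extChartAt I (1 : G)).target) :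
    chartMul I G (extChartAt I (1 : G) 1, u) = u := by
  simp only [chartMul, extChartAt_to_inv, one_mul, (extChartAt I (1 : G)).right_inv hu]

theorem chartMul_right_unit {u : E} (hu : u ∈ (extChartAt I (1 : G)).target) :
    chartMul I G (u, extChartAt I (1 : G) 1) = u := by
  simp only [chartMul, extChartAt_to_inv, mul_one, (extChartAt I (1 : G)).right_inv hu]

variable [LieGroup I ∞ G]

theorem mdifferentiableAt_chart {g : G} (hg : g ∈ (extChartAt I (1 : G)).source) :
    MDifferentiableAt I 𝓘(ℝ, E) (extChartAt I (1 : G)) g := by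
  rw [extChartAt_source] at hg
  exact (contMDiffAt_extChartAt' (n := ∞) hg).mdifferentiableAt (by simp)

theorem chartVec_injective : Function.Injective (chartVec I (G := G)) :=
  (isInvertible_mfderiv_extChartAt (I := I) (mem_extChartAt_source (I := I) (1 : G))).injective

theorem smoothTo_Ad [FiniteDimensional ℝ E] (W : GroupLieAlgebra I G) :
    SmoothTo I fun y : G => Ad I y W := fun l =>
  (LinearMap.toContinuousLinearMap (show E →ₗ[ℝ] ℝ from l)).contMDiff.comp (contMDiff_Ad I W)

variable [I.Boundaryless]

theorem contDiffAt_chartMul {p : E × E} (h₁ : p.1 ∈ (extChartAt I (1 : G)).target)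
    (h₂ : p.2 ∈ (extChartAt I (1 : G)).target)
    (hmul : (extChartAt I (1 : G)).symm p.1 * (extChartAt I (1 : G)).symm p.2 ∈
      (extChartAt I (1 : G)).source) : ContDiffAt ℝ ∞ (chartMul I G) p := by
  have hsymm : ∀ q ∈ (extChartAt I (1 : G)).target,
      ContMDiffAt 𝓘(ℝ, E) I ∞ (extChartAt I (1 : G)).symm q := fun q hq =>
    (contMDiffOn_extChartAt_symm (1 : G)).contMDiffAt (extChartAt_target_mem_nhds' hq)
  have hprod : ContMDiffAt 𝓘(ℝ, E × E) I ∞ (fun p : E × E =>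
      (extChartAt I (1 : G)).symm p.1 * (extChartAt I (1 : G)).symm p.2) p :=
    ((hsymm _ h₁).comp p contDiffAt_fst.contMDiffAt).mul
      ((hsymm _ h₂).comp p contDiffAt_snd.contMDiffAt)
  rw [extChartAt_source] at hmul
  exact ((contMDiffAt_extChartAt' hmul).comp p hprod).contDiffAt

theorem fderiv_chartMul_inr {u : E} (hu : u ∈ (extChartAt I (1 : G)).target)
    (w : GroupLieAlgebra I G) :
    fderiv ℝ (chartMul I G) (u, extChartAt I (1 : G) 1) (0, chartVec I w) =
      (mfderiv I 𝓘(ℝ, E) (fun z : G => extChartAt I (1 : G) ((extChartAt I (1 : G)).symm u * z))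
        (1 : G) : E →L[ℝ] E) w := by
  set φ := extChartAt I (1 : G) with hφ
  have hd : HasFDerivAt (fun v => chartMul I G (u, v))
      (fderiv ℝ (chartMul I G) (u, φ 1) ∘L ContinuousLinearMap.inr ℝ E E) (φ 1) :=
    ((contDiffAt_chartMul I hu (mem_extChartAt_target (1 : G)) (by
      simpa [φ] using φ.map_target hu)).differentiableAt (by simp)).hasFDerivAt.comp (φ 1)
      (hasFDerivAt_prodMk_right u (φ 1))
  have hlocal : (fun v => chartMul I G (u, v)) ∘ φ =ᶠ[𝓝 1] fun z => φ (φ.symm u * z) := by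
    filter_upwards [extChartAt_source_mem_nhds (I := I) (1 : G)] with z hz
    simp only [Function.comp_apply, chartMul, ← hφ, φ.left_inv hz]
  have hcomp := mfderiv_comp_apply_eq (I' := 𝓘(ℝ, E)) (I'' := 𝓘(ℝ, E))
    hd.differentiableAt.mdifferentiableAt
    (mdifferentiableAt_chart I (mem_extChartAt_source (1 : G))) rfl w
  rw [hlocal.mfderiv_eq, mfderiv_eq_fderiv, hd.fderiv] at hcomp
  exact hcomp.symm

theorem fderiv_chartMul_inl {u : E} (hu : u ∈ (extChartAt I (1 : G)).target)
    (w : GroupLieAlgebra I G) :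
    fderiv ℝ (chartMul I G) (extChartAt I (1 : G) 1, u) (chartVec I w, 0) =
      (mfderiv I 𝓘(ℝ, E) (fun z : G => extChartAt I (1 : G) (z * (extChartAt I (1 : G)).symm u))
        (1 : G) : E →L[ℝ] E) w := by
  set φ := extChartAt I (1 : G) with hφ
  have hd : HasFDerivAt (fun v => chartMul I G (v, u))
      (fderiv ℝ (chartMul I G) (φ 1, u) ∘L ContinuousLinearMap.inl ℝ E E) (φ 1) :=
    ((contDiffAt_chartMul I (mem_extChartAt_target (1 : G)) hu (by
      simpa [φ] using φ.map_target hu)).differentiableAt (by simp)).hasFDerivAt.comp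
      (f := fun v : E => (v, u)) (φ 1) (hasFDerivAt_prodMk_left (φ 1) u)
  have hlocal : (fun v => chartMul I G (v, u)) ∘ φ =ᶠ[𝓝 1] fun z => φ (z * φ.symm u) := by
    filter_upwards [extChartAt_source_mem_nhds (I := I) (1 : G)] with z hz
    simp only [Function.comp_apply, chartMul, ← hφ, φ.left_inv hz]
  have hcomp := mfderiv_comp_apply_eq (I' := 𝓘(ℝ, E)) (I'' := 𝓘(ℝ, E))
    hd.differentiableAt.mdifferentiableAt
    (mdifferentiableAt_chart I (mem_extChartAt_source (1 : G))) rfl w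
  rw [hlocal.mfderiv_eq, mfderiv_eq_fderiv, hd.fderiv] at hcomp
  exact hcomp.symm

theorem mpullbackWithin_mulInvariantVectorField {u : E}
    (hu : u ∈ (extChartAt I (1 : G)).target) (w : GroupLieAlgebra I G) :
    VectorField.mpullbackWithin 𝓘(ℝ, E) I (extChartAt I (1 : G)).symm
      (mulInvariantVectorField w : ∀ g : G, TangentSpace I g) (Set.range I) u =
    fderiv ℝ (chartMul I G) (u, extChartAt I (1 : G) 1) (0, chartVec I w) := by
  have hsource := (extChartAt I (1 : G)).map_target hu
  have hfield := mfderiv_comp_apply_eq (mdifferentiableAt_chart I hsource)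
    (mdifferentiableAt_mul_left I _ 1) (mul_one _) w
  rw [fderiv_chartMul_inr I hu]
  refine ((isInvertible_mfderivWithin_extChartAt_symm hu).inverse_apply_eq.2 ?_).trans hfield.symm
  exact (DFunLike.congr_fun (mfderivWithin_extChartAt_symm_comp_mfderiv_extChartAt (I := I) hu)
    (mulInvariantVectorField w ((extChartAt I (1 : G)).symm u))).symm

variable [FiniteDimensional ℝ E]

theorem fderiv_chartMul_Ad {u : E} (hu : u ∈ (extChartAt I (1 : G)).target)
    (w : GroupLieAlgebra I G) :
    fderiv ℝ (chartMul I G) (u, extChartAt I (1 : G) 1) (0, chartVec I w) =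
      fderiv ℝ (chartMul I G) (extChartAt I (1 : G) 1, u)
        (chartVec I (Ad I ((extChartAt I (1 : G)).symm u) w), 0) := by
  rw [fderiv_chartMul_inr I hu, fderiv_chartMul_inl I hu]
  have hg := (extChartAt I (1 : G)).map_target hu
  generalize (extChartAt I (1 : G)).symm u = g at hg ⊢
  have hright : MDifferentiableAt I 𝓘(ℝ, E) (fun z : G => extChartAt I (1 : G) (z * g)) 1 :=
    MDifferentiableAt.comp (g := extChartAt I (1 : G)) (f := (· * g)) 1
      (mdifferentiableAt_chart I (by simpa using hg))
      ((contMDiff_mul_right (I := I) (n := ∞) (a := g)).mdifferentiableAt (by simp))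
  have hconj : (fun z : G => extChartAt I (1 : G) (g * z)) =
      (fun z : G => extChartAt I (1 : G) (z * g)) ∘ conj g := by
    ext z
    simp [conj]
  rw [hconj]
  exact mfderiv_comp_apply_eq hright (mdiff_conj I g 1) (conj_one g) w

theorem differentiableAt_chartVec_Ad (W : GroupLieAlgebra I G) :
    DifferentiableAt ℝ (fun u : E => chartVec I (Ad I ((extChartAt I (1 : G)).symm u) W))
      (extChartAt I (1 : G) 1) := by
  have hsymm : ContMDiffAt 𝓘(ℝ, E) I ∞ (extChartAt I (1 : G)).symm (extChartAt I (1 : G) 1) :=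
    (contMDiffOn_extChartAt_symm (1 : G)).contMDiffAt (extChartAt_target_mem_nhds (1 : G))
  have hAd : ContMDiffAt 𝓘(ℝ, E) 𝓘(ℝ, E) ∞
      (fun u : E => AdL I ((extChartAt I (1 : G)).symm u) W) (extChartAt I (1 : G) 1) :=
    (contMDiff_Ad I W).contMDiffAt.comp _ hsymm
  exact (show E →L[ℝ] E from
    mfderiv I 𝓘(ℝ, E) (extChartAt I (1 : G)) (1 : G)).differentiableAt.comp _
      (hAd.contDiffAt.differentiableAt (by simp))

theorem chartVec_lie (X W : GroupLieAlgebra I G) : chartVec I ⁅X, W⁆ =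
    fderiv ℝ (fun u : E => chartVec I (Ad I ((extChartAt I (1 : G)).symm u) W))
      (extChartAt I (1 : G) 1) (chartVec I X) := by
  have hinv := isInvertible_mfderiv_extChartAt (I := I) (mem_extChartAt_source (I := I) (1 : G))
  set φ := extChartAt I (1 : G)
  have ht : ∀ᶠ u in 𝓝 (φ 1), u ∈ φ.target := extChartAt_target_mem_nhds (1 : G)
  have hbracket : chartVec I ⁅X, W⁆ = VectorField.lieBracketWithin ℝ
      (VectorField.mpullbackWithin 𝓘(ℝ, E) I φ.symm
        (mulInvariantVectorField X : ∀ g : G, TangentSpace I g) (Set.range I))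
      (VectorField.mpullbackWithin 𝓘(ℝ, E) I φ.symm
        (mulInvariantVectorField W : ∀ g : G, TangentSpace I g) (Set.range I))
      (φ.symm ⁻¹' Set.univ ∩ Set.range I) (φ 1) := (hinv.inverse_apply_eq.1 rfl).symm
  have hwithin : ∀ V W : E → E, VectorField.lieBracketWithin ℝ V W
      (φ.symm ⁻¹' Set.univ ∩ Set.range I) = VectorField.lieBracket ℝ V W := fun V W => by
    rw [Set.preimage_univ, I.range_eq_univ, Set.univ_inter, VectorField.lieBracketWithin_univ]
  have hunit : φ.symm (φ 1) * φ.symm (φ 1) ∈ φ.source := by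
    rw [extChartAt_to_inv, mul_one]
    exact mem_extChartAt_source (1 : G)
  have hsmooth : ContDiffAt ℝ ∞ (chartMul I G) (φ 1, φ 1) :=
    contDiffAt_chartMul I (mem_extChartAt_target (1 : G)) (mem_extChartAt_target (1 : G)) hunit
  refine hbracket.trans ((congrFun (hwithin _ _) _).trans ?_)
  exact lieBracket_of_local_product (hsmooth.of_le ENat.LEInfty.out)
    (ht.mono fun u => chartMul_left_unit I) (ht.mono fun u => chartMul_right_unit I)
    (differentiableAt_chartVec_Ad I W)
    (ht.mono fun u hu => fderiv_chartMul_Ad I hu W)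
    (ht.mono fun u hu => mpullbackWithin_mulInvariantVectorField I hu X)
    (ht.mono fun u hu => mpullbackWithin_mulInvariantVectorField I hu W)

theorem vecDeriv_Ad (X W : GroupLieAlgebra I G) :
    vecDeriv I (fun y : G => Ad I y W) 1 X = ⁅X, W⁆ := by
  apply chartVec_injective I
  let τ : GroupLieAlgebra I G →ₗ[ℝ] E :=
    (show E →L[ℝ] E from mfderiv I 𝓘(ℝ, E) (extChartAt I (1 : G)) (1 : G)).toLinearMap
  refine eq_of_forall_linear fun k => (apply_vecDeriv (smoothTo_Ad I W) (k ∘ₗ τ) 1 X).trans ?_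
  rw [chartVec_lie, dirDeriv_eq_fderiv (smoothTo_Ad I W (k ∘ₗ τ))]
  simp only [one_mul]
  exact DFunLike.congr_fun (k.toContinuousLinearMap.hasFDerivAt.comp _
    (differentiableAt_chartVec_Ad I W).hasFDerivAt).fderiv _

end AdjointDerivative

section InnerForms

variable {V : Type*} [AddCommGroup V] [Module ℝ V] [FiniteDimensional ℝ V]

variable (V) in
theorem exists_isInnerForm : ∃ B : LinearMap.BilinForm ℝ V, IsInnerForm B := by
  let e := (Module.finBasis ℝ V).equivFun ≪≫ₗ (WithLp.linearEquiv 2 ℝ (Fin _ → ℝ)).symm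
  refine ⟨(innerₗ (EuclideanSpace ℝ (Fin (Module.finrank ℝ V)))).compl₁₂ e.toLinearMap
    e.toLinearMap, fun X Y => real_inner_comm (e Y) (e X), fun X hX => ?_⟩
  exact real_inner_self_pos.2 (e.map_ne_zero_iff.2 hX)

theorem IsInnerForm.trace_comp_self_neg {B : LinearMap.BilinForm ℝ V} (hB : IsInnerForm B)
    {T : V →ₗ[ℝ] V} (hT : ∀ X Y, B (T X) Y = -B X (T Y)) (hT₀ : T ≠ 0) :
    LinearMap.trace ℝ V (T ∘ₗ T) < 0 := by
  obtain ⟨b, hb⟩ := hB.exists_orthonormal_basis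
  have hrepr (v : V) (i) : b.repr v i = B (b i) v := by
    conv_rhs => rw [← b.sum_repr v, map_sum]
    simp [hb]
  have htrace : LinearMap.trace ℝ V (T ∘ₗ T) = ∑ i, -B (T (b i)) (T (b i)) := by
    rw [LinearMap.trace_eq_matrix_trace ℝ b, Matrix.trace]
    refine Finset.sum_congr rfl fun i _ => ?_
    rw [Matrix.diag_apply, LinearMap.toMatrix_apply, hrepr, LinearMap.comp_apply, hB.symm, hT]
  obtain ⟨i, hi⟩ : ∃ i, T (b i) ≠ 0 := by
    by_contra! hzero
    exact hT₀ (b.ext fun i => by simp [hzero i])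
  rw [htrace, Finset.sum_neg_distrib, neg_lt_zero]
  exact Finset.sum_pos' (fun j _ => hB.nonneg _) ⟨i, Finset.mem_univ _, hB.pos _ hi⟩

end InnerForms

section KillingForm

variable {E : Type*} [NormedAddCommGroup E] [NormedSpace ℝ E] [FiniteDimensional ℝ E]
  {H : Type*} [TopologicalSpace H] (I : ModelWithCorners ℝ E H)
  {G : Type*} [TopologicalSpace G] [ChartedSpace H G] [Group G] [LieGroup I ∞ G]

theorem Ad_injective (y : G) : Function.Injective (Ad I y) :=
  Function.LeftInverse.injective (g := Ad I y⁻¹) (Ad_inv_apply I y)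

section Average

variable (B : LinearMap.BilinForm ℝ (GroupLieAlgebra I G))

theorem continuous_form_Ad (v w : GroupLieAlgebra I G) :
    Continuous fun y : G => B (Ad I y v) (Ad I y w) :=
  ((smoothTo_Ad I v).bilin (smoothTo_Ad I w) B).contMDiff.continuous

variable [CompactSpace G] [MeasurableSpace G] [BorelSpace G] (μ : Measure G)

theorem integrable_form_Ad [IsFiniteMeasure μ] (v w : GroupLieAlgebra I G) :
    Integrable (fun y : G => B (Ad I y v) (Ad I y w)) μ :=
  (continuous_form_Ad I B v w).integrable_of_hasCompactSupport
    (HasCompactSupport.of_compactSpace _)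

/-- The average over `G` of the translates of a bilinear form by the adjoint action. -/
def averageForm [IsFiniteMeasure μ] : LinearMap.BilinForm ℝ (GroupLieAlgebra I G) :=
  LinearMap.mk₂ ℝ (fun v w => ∫ y, B (Ad I y v) (Ad I y w) ∂μ)
    (fun v v' w => by
      simp only [map_add, LinearMap.add_apply]
      exact integral_add (integrable_form_Ad I B μ v w) (integrable_form_Ad I B μ v' w))
    (fun c v w => by
      simp only [map_smul, LinearMap.smul_apply, smul_eq_mul]
      exact integral_const_mul c _)
    (fun v w w' => by
      simp only [map_add]
      exact integral_add (integrable_form_Ad I B μ v w) (integrable_form_Ad I B μ v w'))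
    (fun c v w => by
      simp only [map_smul, smul_eq_mul]
      exact integral_const_mul c _)

theorem averageForm_apply [IsFiniteMeasure μ] (v w : GroupLieAlgebra I G) :
    averageForm I B μ v w = ∫ y, B (Ad I y v) (Ad I y w) ∂μ := rfl

theorem averageForm_Ad [IsFiniteMeasure μ] [μ.IsMulRightInvariant] (x : G)
    (v w : GroupLieAlgebra I G) :
    averageForm I B μ (Ad I x v) (Ad I x w) = averageForm I B μ v w := by
  have := topologicalGroup_of_lieGroup (G := G) I ∞
  simp only [averageForm_apply, ← Ad_mul]
  exact integral_mul_right_eq_self (fun y => B (Ad I y v) (Ad I y w)) x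

variable {B} in
theorem IsInnerForm.averageForm (hB : IsInnerForm B) [IsFiniteMeasure μ] [μ.IsOpenPosMeasure] :
    IsInnerForm (averageForm I B μ) where
  symm v w := by simp only [averageForm_apply, hB.symm]
  pos v hv := (continuous_form_Ad I B v v).integral_pos_of_hasCompactSupport_nonneg_nonzero
    (HasCompactSupport.of_compactSpace _) (fun y => hB.nonneg _)
    (hB.pos _ ((Ad_injective I (1 : G)).ne_iff' (map_zero _) |>.2 hv)).ne'

end Average

variable (G) in
theorem exists_isInnerForm_Ad_invariant [CompactSpace G] :
    ∃ B : LinearMap.BilinForm ℝ (GroupLieAlgebra I G), IsInnerForm B ∧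
      ∀ (x : G) v w, B (Ad I x v) (Ad I x w) = B v w := by
  borelize G
  have := topologicalGroup_of_lieGroup (G := G) I ∞
  have := isMulRightInvariant_of_compactSpace (Measure.haar (G := G))
  obtain ⟨B, hB⟩ := exists_isInnerForm (GroupLieAlgebra I G)
  exact ⟨averageForm I B Measure.haar, hB.averageForm I _, averageForm_Ad I B _⟩

theorem Kil_symm (v w : GroupLieAlgebra I G) : Kil I G v w = Kil I G w v :=
  congrArg Neg.neg (LieModule.traceForm_comm ℝ _ _ v w)

variable [I.Boundaryless]

theorem lie_skew_of_Ad_invariant {B : LinearMap.BilinForm ℝ (GroupLieAlgebra I G)}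
    (hB : ∀ (x : G) v w, B (Ad I x v) (Ad I x w) = B v w) (X v w : GroupLieAlgebra I G) :
    B ⁅X, v⁆ w = -B v ⁅X, w⁆ := by
  have h := dirDeriv_bilin (smoothTo_Ad I v) (smoothTo_Ad I w) B 1 X
  simp only [hB, dirDeriv_const, vecDeriv_Ad, Ad_one, LinearMap.id_apply] at h
  linarith

variable [CompactSpace G] [LieAlgebra.HasTrivialRadical ℝ (GroupLieAlgebra I G)]

variable (G) in
theorem isInnerForm_Kil : IsInnerForm (Kil I G) where
  symm := Kil_symm I
  pos X hX := by
    obtain ⟨B, hB, hAd⟩ := exists_isInnerForm_Ad_invariant I G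
    have had : LieAlgebra.ad ℝ (GroupLieAlgebra I G) X ≠ 0 := fun h => hX <| by
      have hcenter : X ∈ LieAlgebra.center ℝ (GroupLieAlgebra I G) :=
        (LieModule.mem_maxTrivSubmodule (R := ℝ) _ _ _).2 fun Y => by
          rw [← lie_skew, neg_eq_zero]
          exact DFunLike.congr_fun h Y
      rwa [LieAlgebra.center_eq_bot, LieSubmodule.mem_bot] at hcenter
    exact neg_pos.2 (hB.trace_comp_self_neg (lie_skew_of_Ad_invariant I hAd X) had)

variable (K : Subgroup G)

theorem isCompl_mm_lieK : IsCompl (mm I K) (lieK I K) := by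
  refine ((LinearMap.BilinForm.isCompl_orthogonal_iff_disjoint (B := Kil I G)
    fun v w h => by rw [Kil_symm, h]).2 ?_).symm
  rw [Submodule.disjoint_def]
  intro X hX hX'
  by_contra hne
  exact ((isInnerForm_Kil I G).pos X hne).ne' (hX' X hX)

theorem projm_coe (w : mm I K) : projm I K (w : GroupLieAlgebra I G) = w := by
  rw [projm, dif_pos (isCompl_mm_lieK I K)]
  exact Submodule.projectionOnto_apply_left _ w

theorem Kil_projm (X : GroupLieAlgebra I G) (w : mm I K) :
    Kil I G (projm I K X : GroupLieAlgebra I G) w = Kil I G X w := by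
  have hmem : X - projm I K X ∈ lieK I K := by
    rw [projm, dif_pos (isCompl_mm_lieK I K)]
    exact Submodule.sub_projection_mem (isCompl_mm_lieK I K) X
  have := w.2 _ hmem
  rw [map_sub, LinearMap.sub_apply] at this
  linarith

end KillingForm

section Connections

variable {E : Type*} [NormedAddCommGroup E] [NormedSpace ℝ E] [FiniteDimensional ℝ E]
  {H : Type*} [TopologicalSpace H] {I : ModelWithCorners ℝ E H}
  {G : Type*} [TopologicalSpace G] [ChartedSpace H G] [Group G] [LieGroup I ∞ G]
  {K : Subgroup G}

theorem canonical_add_left (U V W : vectorField I K) (x : G) :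
    canonical I K (U + V) W x = canonical I K U W x + canonical I K V W x :=
  (vecDerivLin I W.1 x).map_add (U.1 x : GroupLieAlgebra I G) (V.1 x : GroupLieAlgebra I G)

theorem canonical_mulField_left (f : smoothFun I K) (V W : vectorField I K) (x : G) :
    canonical I K (mulField I K f V) W x = f.1 x • canonical I K V W x :=
  (vecDerivLin I W.1 x).map_smul (f.1 x) (V.1 x : GroupLieAlgebra I G)

theorem canonical_translate (a : G) (V W : vectorField I K) (x : G) :
    canonical I K (translate I K a V) (translate I K a W) x = canonical I K V W (a⁻¹ * x) :=
  vecDeriv_mul_left W.2.1 a⁻¹ x _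

variable [I.Boundaryless]

theorem canonical_add_right (U V W : vectorField I K) (x : G) :
    canonical I K U (V + W) x = canonical I K U V x + canonical I K U W x :=
  vecDeriv_add V.2.1 W.2.1 x _

theorem canonical_mulField_right (f : smoothFun I K) (V W : vectorField I K) (x : G) :
    canonical I K V (mulField I K f W) x =
      f.1 x • canonical I K V W x + dirDeriv I f.1 x (V.1 x : GroupLieAlgebra I G) • W.1 x := by
  have hf := SmoothTo.of_contMDiff f.2.1
  have h := vecDeriv_bilin hf W.2.1 (LinearMap.lsmul ℝ (mm I K)) x
    (V.1 x : GroupLieAlgebra I G)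
  rw [show vecDeriv I f.1 x (V.1 x : GroupLieAlgebra I G) =
    dirDeriv I f.1 x (V.1 x : GroupLieAlgebra I G) from
      apply_vecDeriv hf LinearMap.id x _, add_comm] at h
  exact h

theorem canonical_mul_right (V W : vectorField I K) (x : G) (s : K) :
    canonical I K V W (x * s) = AdK I K s⁻¹ (canonical I K V W x) := by
  unfold canonical
  rw [map_vecDeriv W.2.1]
  simp only [← W.2.2]
  rw [vecDeriv_mul_right W.2.1, V.2.2]
  rfl

end Connections

section Difference

variable {E : Type*} [NormedAddCommGroup E] [NormedSpace ℝ E] [FiniteDimensional ℝ E]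
  {H : Type*} [TopologicalSpace H] {I : ModelWithCorners ℝ E H}
  {G : Type*} [TopologicalSpace G] [ChartedSpace H G] [Group G] [LieGroup I ∞ G]
  {K : Subgroup G}

namespace Connection

variable (D : Connection I K)

theorem diff_add_left (U V W : vectorField I K) (x : G) :
    D.diff (U + V) W x = D.diff U W x + D.diff V W x := by
  unfold diff
  rw [D.add_left, canonical_add_left]
  exact add_sub_add_comm ..

theorem diff_mulField_left (f : smoothFun I K) (V W : vectorField I K) (x : G) :
    D.diff (mulField I K f V) W x = f.1 x • D.diff V W x := by
  unfold diff
  rw [D.smul_left, canonical_mulField_left, smul_sub]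
  rfl

theorem diff_sum_left {ι : Type*} (s : Finset ι) (V : ι → vectorField I K) (W : vectorField I K)
    (x : G) : D.diff (∑ i ∈ s, V i) W x = ∑ i ∈ s, D.diff (V i) W x :=
  map_sum (AddMonoidHom.mk' (fun U => D.diff U W x) fun U V => D.diff_add_left U V W x) V s

theorem diff_translate (hD : D.IsInvariant) (a : G) (V W : vectorField I K) (x : G) :
    D.diff (translate I K a V) (translate I K a W) x = D.diff V W (a⁻¹ * x) := by
  unfold diff
  rw [hD, canonical_translate]
  rfl

variable [I.Boundaryless]

theorem diff_add_right (U V W : vectorField I K) (x : G) :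
    D.diff U (V + W) x = D.diff U V x + D.diff U W x := by
  unfold diff
  rw [D.add_right, canonical_add_right]
  exact add_sub_add_comm ..

theorem diff_mulField_right (f : smoothFun I K) (V W : vectorField I K) (x : G) :
    D.diff V (mulField I K f W) x = f.1 x • D.diff V W x := by
  unfold diff
  rw [D.leibniz, canonical_mulField_right, smul_sub, add_sub_add_right_eq_sub]

theorem diff_sum_right {ι : Type*} (s : Finset ι) (V : vectorField I K) (W : ι → vectorField I K)
    (x : G) : D.diff V (∑ i ∈ s, W i) x = ∑ i ∈ s, D.diff V (W i) x :=
  map_sum (AddMonoidHom.mk' (fun U => D.diff V U x) fun U W => D.diff_add_right V U W x) W s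

theorem diff_mul_right (V W : vectorField I K) (x : G) (s : K) :
    D.diff V W (x * s) = AdK I K s⁻¹ (D.diff V W x) := by
  unfold diff
  rw [canonical_mul_right, (D.toFun V W).2.2, map_sub]

end Connection

end Difference

section RestrictedKillingForm

variable {E : Type*} [NormedAddCommGroup E] [NormedSpace ℝ E] [FiniteDimensional ℝ E]
  {H : Type*} [TopologicalSpace H] (I : ModelWithCorners ℝ E H)
  {G : Type*} [TopologicalSpace G] [ChartedSpace H G] [Group G] [LieGroup I ∞ G] (K : Subgroup G)

/-- The restriction of `Kil` to `𝔪`. -/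
abbrev KilM : LinearMap.BilinForm ℝ (mm I K) := (Kil I G).restrict (mm I K)

theorem isInnerForm_KilM [I.Boundaryless] [CompactSpace G]
    [LieAlgebra.HasTrivialRadical ℝ (GroupLieAlgebra I G)] : IsInnerForm (KilM I K) :=
  (isInnerForm_Kil I G).restrict _

variable {I K}

theorem KilM_AdK (s : K) (v w : mm I K) : KilM I K (AdK I K s v) (AdK I K s w) = KilM I K v w :=
  Kil_Ad I _ _ _

theorem AdK_apply_inv (s : K) (v : mm I K) : AdK I K s (AdK I K s⁻¹ v) = v :=
  Subtype.ext (Ad_apply_inv I (s : G) v)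

end RestrictedKillingForm

section FundamentalFields

variable {E : Type*} [NormedAddCommGroup E] [NormedSpace ℝ E] [FiniteDimensional ℝ E]
  {H : Type*} [TopologicalSpace H] (I : ModelWithCorners ℝ E H) [I.Boundaryless]
  {G : Type*} [TopologicalSpace G] [ChartedSpace H G] [Group G] [LieGroup I ∞ G]
  [CompactSpace G] [LieAlgebra.HasTrivialRadical ℝ (GroupLieAlgebra I G)] (K : Subgroup G)

theorem extendField_apply_self (x : G) (w : mm I K) : (extendField I K x w).1 x = w := by
  change -projm I K (Ad I x⁻¹ (-Ad I x w)) = w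
  rw [map_neg, map_neg, neg_neg, Ad_inv_apply, projm_coe]

/-- A basis of the Lie algebra of `G` which is orthonormal for `Kil`. -/
def kilBasis : Module.Basis (Fin (Module.finrank ℝ (GroupLieAlgebra I G))) ℝ
    (GroupLieAlgebra I G) :=
  (isInnerForm_Kil I G).exists_orthonormal_basis.choose

theorem isDualPair_kilBasis : IsDualPair (Kil I G) (kilBasis I (G := G)) (kilBasis I) :=
  isDualPair_of_basis (isInnerForm_Kil I G).exists_orthonormal_basis.choose_spec

theorem isDualPair_fundField (x : G) : IsDualPair (KilM I K)
    (fun j => (fundField I K (kilBasis I j)).1 x)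
    (fun j => (fundField I K (kilBasis I j)).1 x) := by
  intro v
  have hcoeff (j) : KilM I K ((fundField I K (kilBasis I j)).1 x) v =
      -Kil I G (kilBasis I j) (Ad I x v) := by
    change Kil I G (-projm I K (Ad I x⁻¹ (kilBasis I j)) : mm I K) v = _
    rw [Submodule.coe_neg, map_neg, LinearMap.neg_apply, Kil_projm, Kil_Ad_left]
  calc ∑ j, KilM I K ((fundField I K (kilBasis I j)).1 x) v •
        (fundField I K (kilBasis I j)).1 x
      = ∑ j, Kil I G (kilBasis I j) (Ad I x v) • projm I K (Ad I x⁻¹ (kilBasis I j)) :=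
        Finset.sum_congr rfl fun j _ => by
          rw [hcoeff]
          exact (neg_smul_neg ..)
    _ = projm I K (Ad I x⁻¹ (Ad I x v)) := by
        simp only [← map_smul]
        rw [← map_sum, ← map_sum, isDualPair_kilBasis I (Ad I x v)]
    _ = v := by rw [Ad_inv_apply, projm_coe]

/-- The function `Kil (X̂_j, V)` on `G / K`, the `j`-th coefficient of the vector field `V` with
respect to the fundamental fields of `kilBasis`. -/
def kilCoeff (V : vectorField I K) (j : Fin (Module.finrank ℝ (GroupLieAlgebra I G))) :
    smoothFun I K :=
  ⟨fun x => KilM I K ((fundField I K (kilBasis I j)).1 x) (V.1 x),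
    ((fundField I K (kilBasis I j)).2.1.bilin V.2.1 (KilM I K)).contMDiff,
    fun x s => by
      beta_reduce
      rw [V.2.2, (fundField I K (kilBasis I j)).2.2]
      exact Kil_Ad I _ _ _⟩

theorem eq_sum_mulField (V : vectorField I K) :
    V = ∑ j, mulField I K (kilCoeff I K V j) (fundField I K (kilBasis I j)) := by
  refine Subtype.ext (funext fun x => ?_)
  rw [AddSubmonoidClass.coe_finsetSum, Finset.sum_apply]
  exact (isDualPair_fundField I K x (V.1 x)).symm

end FundamentalFields

namespace Connection

variable {E : Type*} [NormedAddCommGroup E] [NormedSpace ℝ E] [FiniteDimensional ℝ E]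
  {H : Type*} [TopologicalSpace H] {I : ModelWithCorners ℝ E H} [I.Boundaryless]
  {G : Type*} [TopologicalSpace G] [ChartedSpace H G] [Group G] [LieGroup I ∞ G]
  [CompactSpace G] [LieAlgebra.HasTrivialRadical ℝ (GroupLieAlgebra I G)] {K : Subgroup G}
  (D : Connection I K)

theorem diff_eq_sum_left (V W : vectorField I K) (x : G) : D.diff V W x =
    ∑ j, KilM I K ((fundField I K (kilBasis I j)).1 x) (V.1 x) •
      D.diff (fundField I K (kilBasis I j)) W x := by
  conv_lhs => rw [eq_sum_mulField I K V]
  rw [diff_sum_left]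
  exact Finset.sum_congr rfl fun j _ => diff_mulField_left ..

theorem diff_eq_sum_right (V W : vectorField I K) (x : G) : D.diff V W x =
    ∑ j, KilM I K ((fundField I K (kilBasis I j)).1 x) (W.1 x) •
      D.diff V (fundField I K (kilBasis I j)) x := by
  conv_lhs => rw [eq_sum_mulField I K W]
  rw [diff_sum_right]
  exact Finset.sum_congr rfl fun j _ => diff_mulField_right ..

theorem diff_congr {V V' W W' : vectorField I K} {x : G} (hV : V.1 x = V'.1 x)
    (hW : W.1 x = W'.1 x) : D.diff V W x = D.diff V' W' x := by
  rw [diff_eq_sum_left, hV, ← diff_eq_sum_left, diff_eq_sum_right, hW, ← diff_eq_sum_right]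

/-- The bilinear map on `𝔪` which represents `L = ∇ - ∇ᶜ` at the identity, computed on arbitrary
vector fields with the given values there. -/
def diffBilin : mm I K →ₗ[ℝ] mm I K →ₗ[ℝ] mm I K :=
  LinearMap.mk₂ ℝ (fun v w => D.diff (extendField I K 1 v) (extendField I K 1 w) 1)
    (fun v v' w => by
      simp only [D.diff_eq_sum_left (extendField I K 1 _), extendField_apply_self,
        map_add, add_smul, Finset.sum_add_distrib])
    (fun c v w => by
      simp only [D.diff_eq_sum_left (extendField I K 1 _), extendField_apply_self,
        map_smul, smul_assoc, Finset.smul_sum])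
    (fun v w w' => by
      simp only [D.diff_eq_sum_right _ (extendField I K 1 _), extendField_apply_self,
        map_add, add_smul, Finset.sum_add_distrib])
    (fun c v w => by
      simp only [D.diff_eq_sum_right _ (extendField I K 1 _), extendField_apply_self,
        map_smul, smul_assoc, Finset.smul_sum])

theorem diffBilin_apply (v w : mm I K) :
    D.diffBilin v w = D.diff (extendField I K 1 v) (extendField I K 1 w) 1 := rfl

variable {D} in
theorem diffBilin_skew {h : AlmostHermitian I K} (hg : h.IsCompatible D) (u v w : mm I K) :
    h.g (D.diffBilin u v) w = -h.g v (D.diffBilin u w) := by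
  have hcompat := hg (extendField I K 1 u) (extendField I K 1 v) (extendField I K 1 w) 1
  have hprod := dirDeriv_bilin (extendField I K 1 v).2.1 (extendField I K 1 w).2.1 h.g 1
    ((extendField I K 1 u).1 1 : GroupLieAlgebra I G)
  rw [hprod] at hcompat
  simp only [diffBilin_apply, diff, map_sub, LinearMap.sub_apply, extendField_apply_self]
    at hcompat ⊢
  simp only [canonical, extendField_apply_self]
  linarith

variable {D} in
theorem diffBilin_J {h : AlmostHermitian I K} (hJ : h.CommutesWithJ D) (u v : mm I K) :
    D.diffBilin u (h.J v) = h.J (D.diffBilin u v) := by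
  have hJv : (extendField I K 1 (h.J v)).1 1 = (h.Jfield (extendField I K 1 v)).1 1 := by
    rw [extendField_apply_self]
    exact congrArg h.J (extendField_apply_self I K 1 v).symm
  rw [diffBilin_apply, D.diff_congr rfl hJv, diffBilin_apply, diff, diff, hJ, map_sub]
  congr 1
  exact (map_vecDeriv (extendField I K 1 v).2.1 h.J 1 _).symm

variable {D} (hD : D.IsInvariant)
include hD

theorem diff_eq_diffBilin (V W : vectorField I K) (x : G) :
    D.diff V W x = D.diffBilin (V.1 x) (W.1 x) := by
  have htranslate := D.diff_translate hD x⁻¹ V W 1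
  have hone (U : vectorField I K) : (translate I K x⁻¹ U).1 1 = U.1 x := by simp [translate]
  rw [inv_inv, mul_one] at htranslate
  rw [← htranslate, diffBilin_apply]
  exact D.diff_congr ((hone V).trans (extendField_apply_self ..).symm)
    ((hone W).trans (extendField_apply_self ..).symm)

theorem diffEnd_eq_diffBilin (V : vectorField I K) (x : G) (w : mm I K) :
    D.diffEnd V x w = D.diffBilin (V.1 x) w := by
  rw [diffEnd, diff_eq_diffBilin hD, extendField_apply_self]

theorem diffBilin_AdK (s : K) (v w : mm I K) :
    D.diffBilin (AdK I K s v) (AdK I K s w) = AdK I K s (D.diffBilin v w) := by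
  have hs := D.diff_mul_right (extendField I K 1 v) (extendField I K 1 w) 1 s⁻¹
  rwa [diff_eq_diffBilin hD, (extendField I K 1 v).2.2, (extendField I K 1 w).2.2,
    extendField_apply_self, extendField_apply_self, inv_inv] at hs

end Connection

section FormSquareRoots

variable {V : Type*} [AddCommGroup V] [Module ℝ V]

/-- `R` is a square root, symmetric and positive for `B`, of the operator `S` with
`g (X, Y) = B (S X, Y)`. -/
structure IsFormSqrt (B g : LinearMap.BilinForm ℝ V) (R : Module.End ℝ V) : Prop where
  symm : ∀ X Y, B (R X) Y = B X (R Y)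
  pos : ∀ X, X ≠ 0 → 0 < B (R X) X
  form_eq : ∀ X Y, g X Y = B (R X) (R Y)

namespace IsFormSqrt

variable {B g : LinearMap.BilinForm ℝ V} {R : Module.End ℝ V} [FiniteDimensional ℝ V]
  (hR : IsFormSqrt B g R)
include hR

theorem isUnit : IsUnit R := by
  rw [LinearMap.isUnit_iff_ker_eq_bot, LinearMap.ker_eq_bot']
  intro X hX
  by_contra hne
  simpa [hX] using hR.pos X hne

theorem apply_inverse (X : V) : R (Ring.inverse R X) = X :=
  DFunLike.congr_fun (Ring.mul_inverse_cancel _ hR.isUnit) X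

theorem inverse_apply (X : V) : Ring.inverse R (R X) = X :=
  DFunLike.congr_fun (Ring.inverse_mul_cancel _ hR.isUnit) X

theorem form_inverse_left (X Y : V) : g (Ring.inverse R X) Y = B X (R Y) := by
  rw [hR.form_eq, hR.apply_inverse]

theorem form_inverse_symm (X Y : V) : g (Ring.inverse R X) Y = g X (Ring.inverse R Y) := by
  rw [hR.form_inverse_left, hR.form_eq, hR.apply_inverse, hR.symm]

theorem isDualPair_inverse {ι : Type*} [Fintype ι] {a b : ι → V} (hab : IsDualPair B a b) :
    IsDualPair g (fun j => Ring.inverse R (a j)) fun j => Ring.inverse R (b j) := fun v => by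
  simp only [hR.form_inverse_left, ← map_smul]
  rw [← map_sum, hab, hR.inverse_apply]

theorem isDualPair_apply_inverse {ι : Type*} [Fintype ι] {a b : ι → V} (hab : IsDualPair g a b) :
    IsDualPair g (fun j => R (a j)) fun j => Ring.inverse R (b j) := fun v => by
  simp only [hR.form_inverse_symm, ← map_smul]
  rw [← map_sum, hab, hR.apply_inverse]

theorem commute_inverse {T : Module.End ℝ V} (hT : Commute T R) : Commute T (Ring.inverse R) := by
  obtain ⟨u, rfl⟩ := hR.isUnit
  rw [Ring.inverse_unit]
  exact hT.units_inv_right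

end IsFormSqrt

end FormSquareRoots

namespace AlmostHermitian

section MetricOperator

variable {E : Type*} [NormedAddCommGroup E] [NormedSpace ℝ E] [FiniteDimensional ℝ E]
  {H : Type*} [TopologicalSpace H] {I : ModelWithCorners ℝ E H}
  {G : Type*} [TopologicalSpace G] [ChartedSpace H G] [Group G] [LieGroup I ∞ G] {K : Subgroup G}
  (h : AlmostHermitian I K)

theorem g_AdK_left (s : K) (X Y : mm I K) : h.g (AdK I K s X) Y = h.g X (AdK I K s⁻¹ Y) := by
  rw [← h.g_Ad s X, AdK_apply_inv]

theorem isDualPair_dualBasis : IsDualPair h.g (Module.finBasis ℝ (mm I K))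
    (h.g.dualBasis h.nondegenerate (Module.finBasis ℝ (mm I K))) :=
  isDualPair_of_basis fun p q => by
    rw [LinearMap.BilinForm.apply_dualBasis_left]
    simp only [eq_comm]

variable [I.Boundaryless] [CompactSpace G] [LieAlgebra.HasTrivialRadical ℝ (GroupLieAlgebra I G)]

theorem metricOp_spec (X Y : mm I K) : h.g X Y = KilM I K (h.metricOp X) Y := by
  have hKil := (isInnerForm_KilM I K).nondegenerate
  exact Classical.epsilon_spec
    (p := fun S : mm I K →ₗ[ℝ] mm I K => ∀ X Y, h.g X Y = KilM I K (S X) Y)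
    ⟨((KilM I K).toDual hKil).symm ∘ₗ h.g, fun X Y =>
      (LinearMap.BilinForm.apply_toDual_symm_apply (hB := hKil) (h.g X) Y).symm⟩ X Y

theorem metricOp_AdK (s : K) (X : mm I K) :
    h.metricOp (AdK I K s X) = AdK I K s (h.metricOp X) := by
  refine sub_eq_zero.1 ((isInnerForm_KilM I K).nondegenerate.1 _ fun Y => ?_)
  rw [map_sub, LinearMap.sub_apply, ← metricOp_spec, ← AdK_apply_inv s Y, KilM_AdK,
    ← metricOp_spec, h.g_Ad, sub_self]

theorem exists_polynomial_sqrt_metricOp : ∃ p : Polynomial ℝ,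
    (∀ X Y, KilM I K (Polynomial.aeval h.metricOp p X) Y =
      KilM I K X (Polynomial.aeval h.metricOp p Y)) ∧
    (∀ X, X ≠ 0 → 0 < KilM I K (Polynomial.aeval h.metricOp p X) X) ∧
    Polynomial.aeval h.metricOp p ∘ₗ Polynomial.aeval h.metricOp p = h.metricOp :=
  (isInnerForm_KilM I K).exists_polynomial_sqrt
    (fun X Y => by rw [← h.metricOp_spec, h.symm, h.metricOp_spec, (isInnerForm_KilM I K).symm])
    fun X hX => (h.pos X hX).trans_eq (h.metricOp_spec X X)

theorem isFormSqrt_of_comp_self {R : Module.End ℝ (mm I K)}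
    (hsymm : ∀ X Y, KilM I K (R X) Y = KilM I K X (R Y))
    (hpos : ∀ X, X ≠ 0 → 0 < KilM I K (R X) X) (hsq : R ∘ₗ R = h.metricOp) :
    IsFormSqrt (KilM I K) h.g R :=
  ⟨hsymm, hpos, fun X Y => by rw [h.metricOp_spec, ← hsq, LinearMap.comp_apply, hsymm]⟩

theorem isFormSqrt_metricOpSqrt : IsFormSqrt (KilM I K) h.g h.metricOpSqrt := by
  obtain ⟨p, hp⟩ := h.exists_polynomial_sqrt_metricOp
  obtain ⟨hsymm, hpos, hsq⟩ := Classical.epsilon_spec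
    (p := fun R : mm I K →ₗ[ℝ] mm I K => (∀ X Y, KilM I K (R X) Y = KilM I K X (R Y)) ∧
      (∀ X, X ≠ 0 → 0 < KilM I K (R X) X) ∧ R ∘ₗ R = h.metricOp) ⟨_, hp⟩
  exact h.isFormSqrt_of_comp_self hsymm hpos hsq

/-- Being a polynomial in `S`, the square root commutes with everything that commutes with `S`. -/
theorem exists_isFormSqrt_commute :
    ∃ R, IsFormSqrt (KilM I K) h.g R ∧ ∀ s : K, Commute (AdK I K s) R := by
  obtain ⟨p, hsymm, hpos, hsq⟩ := h.exists_polynomial_sqrt_metricOp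
  refine ⟨_, h.isFormSqrt_of_comp_self hsymm hpos hsq, fun s => ?_⟩
  have hcomm : Commute (AdK I K s : Module.End ℝ (mm I K)) h.metricOp :=
    LinearMap.ext fun X => (h.metricOp_AdK s X).symm
  exact Algebra.commute_of_mem_adjoin_singleton_of_commute
    (Polynomial.aeval_mem_adjoin_singleton ℝ _) hcomm

theorem exists_isStandardFrame :
    ∃ (n : ℕ) (W : Fin n → vectorField I K), h.IsStandardFrame W := by
  obtain ⟨R, hR, hcomm⟩ := h.exists_isFormSqrt_commute
  refine ⟨_, fun j => ⟨fun x => Ring.inverse R ((fundField I K (kilBasis I j)).1 x),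
    (fundField I K (kilBasis I j)).2.1.comp_linear _, fun x s => ?_⟩, fun V x =>
      (hR.isDualPair_inverse (isDualPair_fundField I K x) (V.1 x)).symm⟩
  beta_reduce
  rw [(fundField I K (kilBasis I j)).2.2]
  exact (DFunLike.congr_fun (hR.commute_inverse (hcomm s⁻¹)).eq _).symm

end MetricOperator

section DifferenceTrace

variable {E : Type*} [NormedAddCommGroup E] [NormedSpace ℝ E] [FiniteDimensional ℝ E]
  {H : Type*} [TopologicalSpace H] {I : ModelWithCorners ℝ E H} [I.Boundaryless]
  {G : Type*} [TopologicalSpace G] [ChartedSpace H G] [Group G] [LieGroup I ∞ G]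
  [CompactSpace G] [LieAlgebra.HasTrivialRadical ℝ (GroupLieAlgebra I G)] {K : Subgroup G}
  (h : AlmostHermitian I K)

/-- The trace `∑ₚ L_{eₚ} eᵖ` of `L = ∇ - ∇ᶜ` with respect to `g`. -/
def diffTrace (D : Connection I K) : mm I K :=
  ∑ p, D.diffBilin (Module.finBasis ℝ (mm I K) p)
    (h.g.dualBasis h.nondegenerate (Module.finBasis ℝ (mm I K)) p)

theorem sum_diffBilin (D : Connection I K) {ι : Type*} [Fintype ι] {a b : ι → mm I K}
    (hab : IsDualPair h.g a b) : ∑ j, D.diffBilin (a j) (b j) = h.diffTrace D :=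
  hab.sum_eq h.nondegenerate h.isDualPair_dualBasis D.diffBilin

variable {D : Connection I K} (hD : D.IsInvariant)
include hD

theorem sum_diff_of_isStandardFrame {n : ℕ} {W : Fin n → vectorField I K}
    (hW : h.IsStandardFrame W) (x : G) : ∑ j, D.diff (W j) (W j) x = h.diffTrace D := by
  simp only [D.diff_eq_diffBilin hD]
  refine h.sum_diffBilin D (a := fun j => (W j).1 x) (b := fun j => (W j).1 x) fun v => ?_
  have hv := hW (extendField I K x v) x
  rw [extendField_apply_self] at hv
  exact hv.symm

theorem AdK_diffTrace (s : K) : AdK I K s (h.diffTrace D) = h.diffTrace D := by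
  conv_lhs => rw [diffTrace, map_sum]
  simp only [← D.diffBilin_AdK hD]
  refine h.sum_diffBilin D (a := fun p => AdK I K s (Module.finBasis ℝ (mm I K) p))
    (b := fun p => AdK I K s (h.g.dualBasis h.nondegenerate (Module.finBasis ℝ (mm I K)) p))
    fun v => ?_
  simp only [g_AdK_left, ← map_smul]
  rw [← map_sum, h.isDualPair_dualBasis, AdK_apply_inv]

theorem ikedaSum_eq {Y : Module.Basis (Fin (Module.finrank ℝ (mm I K))) ℝ (mm I K)}
    (hY : h.IsOrthonormal Y) : h.ikedaSum D Y = -h.diffTrace D := by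
  have hdual : IsDualPair h.g (fun p => h.metricOpSqrt (Y p)) fun p => h.metricOpInvSqrt (Y p) :=
    h.isFormSqrt_metricOpSqrt.isDualPair_apply_inverse (isDualPair_of_basis hY)
  have hfund (X : mm I K) : (fundField I K (X : GroupLieAlgebra I G)).1 1 = -X := by
    change -projm I K (Ad I 1⁻¹ (X : GroupLieAlgebra I G)) = -X
    rw [inv_one, Ad_one, LinearMap.id_apply, projm_coe]
  rw [← h.sum_diffBilin D hdual, ikedaSum, ← Finset.sum_neg_distrib]
  refine Finset.sum_congr rfl fun p _ => ?_
  rw [D.diffEnd_eq_diffBilin hD, hfund, map_neg, LinearMap.neg_apply]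

end DifferenceTrace

end AlmostHermitian

section Integration

variable {E : Type*} [NormedAddCommGroup E] [NormedSpace ℝ E]
  {H : Type*} [TopologicalSpace H] {I : ModelWithCorners ℝ E H}
  {G : Type*} [TopologicalSpace G] [ChartedSpace H G] {f : G → ℂ}

theorem SmoothTo.continuous_complex (hf : SmoothTo I f) : Continuous f := by
  have hre : Continuous fun x => (f x).re := (hf Complex.reLm).continuous
  have him : Continuous fun x => (f x).im := (hf Complex.imLm).continuous
  simpa only [Complex.re_add_im] using
    (by fun_prop : Continuous fun x => ((f x).re : ℂ) + (f x).im * Complex.I)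

variable [CompactSpace G] [MeasurableSpace G] [BorelSpace G] (μ : Measure G)

theorem SmoothTo.integrable [IsFiniteMeasureOnCompacts μ] (hf : SmoothTo I f) : Integrable f μ :=
  hf.continuous_complex.integrable_of_hasCompactSupport (HasCompactSupport.of_compactSpace f)

theorem integral_vecDeriv [FiniteDimensional ℝ E] [I.Boundaryless] [Group G] [LieGroup I ∞ G]
    [μ.IsHaarMeasure] (hf : SmoothTo I f) (v : GroupLieAlgebra I G) :
    ∫ x, vecDeriv I f x v ∂μ = 0 := by
  unfold vecDeriv
  rw [integral_finsetSum _ fun i _ =>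
    ((contMDiff_dirDeriv (hf _) v).continuous.integrable_of_hasCompactSupport
      (HasCompactSupport.of_compactSpace _)).smul_const _]
  refine Finset.sum_eq_zero fun i _ => ?_
  rw [integral_smul_const, integral_dirDeriv μ (hf _), zero_smul]

end Integration

section CharacterAverage

variable {G : Type*} [TopologicalSpace G] [Group G] {K : Subgroup G} (χ : K →ₜ* Circle)

theorem continuous_character : Continuous fun s : K => (χ s : ℂ) :=
  continuous_subtype_val.comp χ.continuous_toFun

variable [MeasurableSpace G] (ν : Measure K)

/-- The average `x ↦ ∫_K χ(s) b(xs) ds` of a function `b` on `G` over the right action of `K`, with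
weight a character of `K`. It makes an arbitrary function transform by the conjugate character. -/
def characterAverage (b : G → ℝ) (x : G) : ℂ :=
  ∫ s : K, (χ s : ℂ) * b (x * s) ∂ν

theorem linear_characterAverage [IsTopologicalGroup G] [BorelSpace G] [CompactSpace K]
    [IsFiniteMeasureOnCompacts ν] {b : G → ℝ} (hb : Continuous b) (l : ℂ →ₗ[ℝ] ℝ) (x : G) :
    l (characterAverage χ ν b x) = ∫ s : K, l (χ s : ℂ) * b (x * s) ∂ν := by
  have hcont : Continuous fun s : K => (χ s : ℂ) * (b (x * s) : ℂ) :=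
    (continuous_character χ).mul (Complex.continuous_ofReal.comp (hb.comp (by fun_prop)))
  refine (l.toContinuousLinearMap.integral_comp_comm
    (hcont.integrable_of_hasCompactSupport (HasCompactSupport.of_compactSpace _))).symm.trans
    (integral_congr_ae (.of_forall fun s => ?_))
  change l ((χ s : ℂ) * (b (x * s) : ℂ)) = l (χ s : ℂ) * b (x * s)
  rw [mul_comm, ← Complex.real_smul, map_smul, smul_eq_mul, mul_comm]

theorem characterAverage_mul_right [IsTopologicalGroup G] [BorelSpace G] [ν.IsMulLeftInvariant]
    (b : G → ℝ) (x : G) (s : K) :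
    characterAverage χ ν b (x * s) = starRingEnd ℂ (χ s : ℂ) * characterAverage χ ν b x := by
  unfold characterAverage
  rw [← integral_const_mul, ← integral_mul_left_eq_self
    (fun t : K => starRingEnd ℂ (χ s : ℂ) * ((χ t : ℂ) * (b (x * t) : ℂ))) s]
  refine integral_congr_ae (.of_forall fun t => ?_)
  have hχ : starRingEnd ℂ (χ s : ℂ) * (χ s : ℂ) = 1 := by
    rw [← Circle.coe_inv_eq_conj, ← Circle.coe_mul, inv_mul_cancel, Circle.coe_one]
  beta_reduce
  rw [map_mul, Circle.coe_mul, Subgroup.coe_mul, ← mul_assoc x, ← mul_assoc, ← mul_assoc, hχ,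
    one_mul]

theorem characterAverage_one_ne_zero [IsTopologicalGroup G] [BorelSpace G] [CompactSpace K]
    [IsFiniteMeasureOnCompacts ν] [ν.IsOpenPosMeasure] {b : G → ℝ} (hb : Continuous b)
    (hb0 : ∀ x, 0 ≤ b x) (hb1 : b 1 ≠ 0) (hχ : ∀ s : K, b s ≠ 0 → 0 < (χ s : ℂ).re) :
    characterAverage χ ν b 1 ≠ 0 := fun hzero => by
  have hre := linear_characterAverage χ ν hb Complex.reLm 1
  rw [hzero, map_zero] at hre
  refine hre.not_lt (Continuous.integral_pos_of_hasCompactSupport_nonneg_nonzero (x := (1 : K))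
    ((Complex.continuous_re.comp (continuous_character χ)).mul (hb.comp (by fun_prop)))
    (HasCompactSupport.of_compactSpace _) (fun s => ?_) (by simpa using hb1))
  rw [one_mul]
  by_cases hs : b s = 0
  · simp only [hs, mul_zero, Pi.zero_apply, le_refl]
  · exact mul_nonneg (hχ s hs).le (hb0 s)

variable {E : Type*} [NormedAddCommGroup E] [NormedSpace ℝ E] [FiniteDimensional ℝ E]
  {H : Type*} [TopologicalSpace H] {I : ModelWithCorners ℝ E H} [I.Boundaryless]
  [ChartedSpace H G] [LieGroup I ∞ G] [BorelSpace G]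

theorem smoothTo_characterAverage [CompactSpace K] [IsFiniteMeasure ν] {b : G → ℝ}
    (hb : ContMDiff I 𝓘(ℝ, ℝ) ∞ b) : SmoothTo I (characterAverage χ ν b) := fun l => by
  have : IsTopologicalGroup G := topologicalGroup_of_lieGroup I ∞
  simp only [linear_characterAverage χ ν hb.continuous l]
  exact contMDiff_convolution continuous_subtype_val
    (l.continuous_of_finiteDimensional.comp (continuous_character χ)) ν hb

variable (I) in
theorem exists_equivariant_function [T2Space G] (hK : IsCompact (K : Set G)) :
    ∃ F : G → ℂ, SmoothTo I F ∧ (∀ (x : G) (s : K), F (x * s) = starRingEnd ℂ (χ s : ℂ) * F x) ∧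
      F 1 ≠ 0 := by
  have : IsTopologicalGroup G := topologicalGroup_of_lieGroup I ∞
  have : CompactSpace K := isCompact_iff_compactSpace.1 hK
  have hχ1 : {s : K | 0 < (χ s : ℂ).re} ∈ nhds (1 : K) :=
    (isOpen_lt continuous_const (Complex.continuous_re.comp (continuous_character χ))).mem_nhds
      (by simp)
  rw [nhds_subtype_eq_comap, Filter.mem_comap] at hχ1
  obtain ⟨N, hN, hNχ⟩ := hχ1
  obtain ⟨b, -, hbN⟩ := (SmoothBumpFunction.nhds_basis_tsupport (I := I) (1 : G)).mem_iff.1 hN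
  have hb : ContMDiff I 𝓘(ℝ, ℝ) ∞ b := b.contMDiff
  refine ⟨characterAverage χ Measure.haar b, smoothTo_characterAverage χ _ hb,
    characterAverage_mul_right χ _ b, characterAverage_one_ne_zero χ _ hb.continuous
      (fun _ => b.nonneg) (by simp) fun s hs => hNχ (hbN (subset_tsupport b hs))⟩

end CharacterAverage

section Dirac

namespace AlmostHermitian

variable {E : Type*} [NormedAddCommGroup E] [NormedSpace ℝ E] [FiniteDimensional ℝ E]
  {H : Type*} [TopologicalSpace H] {I : ModelWithCorners ℝ E H}
  {G : Type*} [TopologicalSpace G] [ChartedSpace H G] [Group G] [LieGroup I ∞ G] {K : Subgroup G}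
  (h : AlmostHermitian I K)

theorem isSpinorField_smul {χ : K →ₜ* Circle} {F : G → ℂ} (hF : SmoothTo I F)
    (hFχ : ∀ (x : G) (s : K), F (x * s) = starRingEnd ℂ (χ s : ℂ) * F x) {w : h.Spinor}
    (hw : ∀ s, h.AdSpin s w = w) : h.IsSpinorField χ fun x => F x • w :=
  ⟨hF.comp_linear ((LinearMap.toSpanSingleton ℂ h.Spinor w).restrictScalars ℝ), fun x s => by
    beta_reduce
    rw [map_smul, hw, hFχ, mul_smul]⟩

theorem AdSpin_ι (s : K) (X : mm I K) : h.AdSpin s (ExteriorAlgebra.ι ℂ (h.toMJ X)) =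
    ExteriorAlgebra.ι ℂ (h.toMJ (AdK I K s X)) := by
  unfold AdSpin
  rw [ExteriorAlgebra.map_apply_ι]
  rfl

variable [I.Boundaryless] [CompactSpace G] [LieAlgebra.HasTrivialRadical ℝ (GroupLieAlgebra I G)]
  {D : Connection I K} (hD : D.IsInvariant) (hg : h.IsCompatible D) (hJ : h.CommutesWithJ D)

/-- The endomorphism `L_v` of `𝔪_J`, complex linear because `∇` commutes with `J`. -/
def diffComplex (v : mm I K) : h.MJ →ₗ[ℂ] h.MJ :=
  h.complexify (D.diffBilin v) (Connection.diffBilin_J hJ v)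

include hD

theorem diffSpin_eq (V : vectorField I K) (x : G) :
    h.diffSpin D V x = h.extDer (h.diffComplex hJ (V.1 x)) := by
  have hL : ∃ l : h.MJ →ₗ[ℂ] h.MJ, ∀ w, l (h.toMJ w) = h.toMJ (D.diffEnd V x w) :=
    ⟨h.diffComplex hJ (V.1 x), fun w => by rw [Connection.diffEnd_eq_diffBilin hD]; rfl⟩
  unfold diffSpin
  rw [dif_pos hL]
  congr 1
  refine LinearMap.ext fun w => (hL.choose_spec (h.toMJ.symm w)).trans ?_
  rw [Connection.diffEnd_eq_diffBilin hD]
  rfl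

theorem dirac_eq (ψ : G → h.Spinor) (x : G) : h.dirac D ψ x =
    ∑ p, h.clifford (h.g.dualBasis h.nondegenerate (Module.finBasis ℝ (mm I K)) p)
      (vecDeriv I ψ x (Module.finBasis ℝ (mm I K) p : GroupLieAlgebra I G) +
        h.extDer (h.diffComplex hJ (Module.finBasis ℝ (mm I K) p)) (ψ x)) := by
  unfold dirac spinConnection
  refine Finset.sum_congr rfl fun p _ => ?_
  rw [h.diffSpin_eq hD hJ, extendField_apply_self]

variable {ψ φ : G → h.Spinor} (hψ : SmoothTo I ψ) (hφ : SmoothTo I φ)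

include hJ hψ

theorem smoothTo_dirac : SmoothTo I (h.dirac D ψ) := by
  simp only [funext (h.dirac_eq hD hJ ψ)]
  exact SmoothTo.sum _ fun p => ((hψ.vecDeriv _).add (hψ.comp_linear
    ((h.extDer (h.diffComplex hJ _)).restrictScalars ℝ))).comp_linear
      ((h.clifford _).restrictScalars ℝ)

include hg hφ

/-- Leibniz' rule produces the divergence. The derivations extending `L_{eₚ}` are skew, so their
terms cancel up to the commutators `κ (L_{eₚ} eᵖ)` with Clifford multiplication. -/
theorem spinInner_dirac_sub (x : G) :
    h.spinInner (h.dirac D ψ x) (φ x) - h.spinInner (ψ x) (h.dirac D φ x) =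
      h.spinInner (ψ x) (h.clifford (h.diffTrace D) (φ x)) -
      ∑ p, vecDeriv I (fun y => h.spinInner (ψ y)
        (h.clifford (h.g.dualBasis h.nondegenerate (Module.finBasis ℝ (mm I K)) p) (φ y))) x
          (Module.finBasis ℝ (mm I K) p : GroupLieAlgebra I G) := by
  rw [h.dirac_eq hD hJ, h.dirac_eq hD hJ, diffTrace, HermSpace.clifford_sum]
  simp only [← HermSpace.spinForm_apply, map_sum, LinearMap.sum_apply, ← Finset.sum_sub_distrib]
  refine Finset.sum_congr rfl fun p _ => ?_
  generalize Module.finBasis ℝ (mm I K) p = e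
  generalize h.g.dualBasis h.nondegenerate (Module.finBasis ℝ (mm I K)) p = e'
  have leibniz : vecDeriv I (fun y => h.spinInner (ψ y) (h.clifford e' (φ y))) x
      (e : GroupLieAlgebra I G) = h.spinInner (vecDeriv I ψ x e) (h.clifford e' (φ x)) +
        h.spinInner (ψ x) (h.clifford e' (vecDeriv I φ x e)) := by
    refine (vecDeriv_bilin hψ (hφ.comp_linear ((h.clifford e').restrictScalars ℝ)) h.spinForm x
      _).trans ?_
    rw [← map_vecDeriv hφ]
    rfl
  have hskew := Connection.diffBilin_skew hg e
  simp only [map_add, LinearMap.add_apply, HermSpace.spinForm_apply, leibniz,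
    HermSpace.spinInner_clifford_left, diffComplex]
  rw [h.spinInner_extDer_left _ hskew, h.extDer_clifford _ hskew, h.spinInner_add_right]
  ring

variable [MeasurableSpace G] [BorelSpace G] (μ : Measure G) [μ.IsHaarMeasure]

theorem integral_dirac_sub :
    ∫ x, h.spinInner (h.dirac D ψ x) (φ x) ∂μ - ∫ x, h.spinInner (ψ x) (h.dirac D φ x) ∂μ =
      ∫ x, h.spinInner (ψ x) (h.clifford (h.diffTrace D) (φ x)) ∂μ := by
  have smooth_inner_clifford (X : mm I K) :
      SmoothTo I fun y => h.spinInner (ψ y) (h.clifford X (φ y)) :=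
    hψ.bilin (hφ.comp_linear ((h.clifford X).restrictScalars ℝ)) h.spinForm
  have integrable_left : Integrable (fun x => h.spinInner (h.dirac D ψ x) (φ x)) μ :=
    ((h.smoothTo_dirac hD hJ hψ).bilin hφ h.spinForm).integrable μ
  have integrable_right : Integrable (fun x => h.spinInner (ψ x) (h.dirac D φ x)) μ :=
    (hψ.bilin (h.smoothTo_dirac hD hJ hφ) h.spinForm).integrable μ
  have integrable_divergence (X v : mm I K) : Integrable (fun x => vecDeriv I
      (fun y => h.spinInner (ψ y) (h.clifford X (φ y))) x (v : GroupLieAlgebra I G)) μ :=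
    ((smooth_inner_clifford X).vecDeriv _).integrable μ
  rw [← integral_sub integrable_left integrable_right]
  simp only [h.spinInner_dirac_sub hD hg hJ hψ hφ]
  rw [integral_sub ((smooth_inner_clifford _).integrable μ)
    (integrable_finsetSum _ fun p _ => integrable_divergence _ _),
    integral_finsetSum _ fun p _ => integrable_divergence _ _]
  simp only [integral_vecDeriv μ (smooth_inner_clifford _), Finset.sum_const_zero, sub_zero]

end AlmostHermitian

end Dirac

section SelfAdjointness

namespace AlmostHermitian

variable {E : Type*} [NormedAddCommGroup E] [NormedSpace ℝ E] [FiniteDimensional ℝ E]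
  {H : Type*} [TopologicalSpace H] {I : ModelWithCorners ℝ E H}
  {G : Type*} [TopologicalSpace G] [ChartedSpace H G] [Group G] [LieGroup I ∞ G] {K : Subgroup G}
  (h : AlmostHermitian I K) [CompactSpace G] [MeasurableSpace G] [BorelSpace G]
  (μ : Measure G)

theorem integral_spinInner_smul_clifford_ne_zero [IsFiniteMeasureOnCompacts μ] [μ.IsOpenPosMeasure]
    {F : G → ℂ} (hF : Continuous F) {x : G} (hx : F x ≠ 0) {Z : mm I K} (hZ : Z ≠ 0) :
    ∫ x, h.spinInner (F x • ExteriorAlgebra.ι ℂ (h.toMJ Z)) (h.clifford Z (F x • 1)) ∂μ ≠ 0 := by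
  have normSq_pos : 0 < ∫ x, Complex.normSq (F x) ∂μ :=
    (Complex.continuous_normSq.comp hF).integral_pos_of_hasCompactSupport_nonneg_nonzero
      (HasCompactSupport.of_compactSpace _) (fun x => Complex.normSq_nonneg _)
      (Complex.normSq_eq_zero.not.2 hx)
  simp only [map_smul, HermSpace.spinInner_smul_left, HermSpace.spinInner_smul_right,
    HermSpace.spinInner_ι_clifford_one, ← mul_assoc, Complex.mul_conj]
  rw [integral_mul_const, integral_mul_const, integral_complex_ofReal]
  exact mul_ne_zero (mul_ne_zero (Complex.ofReal_ne_zero.2 normSq_pos.ne') Complex.I_ne_zero)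
    (h.herm_self_ne_zero hZ)

variable [I.Boundaryless] [LieAlgebra.HasTrivialRadical ℝ (GroupLieAlgebra I G)]

theorem isFormallySelfAdjoint_iff [T2Space G] [μ.IsHaarMeasure] (hK : IsClosed (K : Set G))
    {D : Connection I K} (hD : D.IsInvariant) (hg : h.IsCompatible D) (hJ : h.CommutesWithJ D)
    (χ : K →ₜ* Circle) : h.IsFormallySelfAdjoint μ D χ ↔ h.diffTrace D = 0 := by
  refine ⟨fun hsa => ?_, fun hZ ψ φ hψ hφ => ?_⟩
  · obtain ⟨F, hF, hFχ, hF1⟩ := exists_equivariant_function χ I hK.isCompact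
    by_contra hZ
    have vacuum : h.IsSpinorField χ fun x => F x • (1 : h.Spinor) :=
      h.isSpinorField_smul hF hFχ fun s => map_one (h.AdSpin s)
    have oneParticle : h.IsSpinorField χ fun x => F x • ExteriorAlgebra.ι ℂ (h.toMJ
        (h.diffTrace D)) :=
      h.isSpinorField_smul hF hFχ fun s => by rw [h.AdSpin_ι, h.AdK_diffTrace hD]
    refine h.integral_spinInner_smul_clifford_ne_zero μ hF.continuous_complex hF1 hZ ?_
    rw [← h.integral_dirac_sub hD hg hJ oneParticle.1 vacuum.1, hsa _ _ oneParticle vacuum,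
      sub_self]
  · rw [← sub_eq_zero, h.integral_dirac_sub hD hg hJ hψ.1 hφ.1, hZ]
    simp only [HermSpace.clifford_zero, HermSpace.spinInner_zero_right, integral_zero]

end AlmostHermitian

end SelfAdjointness

end HomDirac

end

theorem corollary7p7
    {E : Type*} [NormedAddCommGroup E] [NormedSpace ℝ E] [FiniteDimensional ℝ E]
    {H : Type*} [TopologicalSpace H] (I : ModelWithCorners ℝ E H) [I.Boundaryless]
    {G : Type*} [TopologicalSpace G] [ChartedSpace H G] [Group G] [LieGroup I ∞ G]
    [T2Space G] [CompactSpace G] [LieAlgebra.IsSemisimple ℝ (GroupLieAlgebra I G)]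
    [MeasurableSpace G] [BorelSpace G] (μ : MeasureTheory.Measure G) [μ.IsHaarMeasure]
    (K : Subgroup G) (hK : IsClosed (K : Set G))
    (h : HomDirac.AlmostHermitian I K) (χ : K →ₜ* Circle)
    (D : HomDirac.Connection I K) (hD : D.IsInvariant) (hg : h.IsCompatible D)
    (hJ : h.CommutesWithJ D) :
    (h.IsFormallySelfAdjoint μ D χ ↔
      ∀ (n : ℕ) (W : Fin n → HomDirac.vectorField I K), h.IsStandardFrame W →
        ∀ x : G, ∑ j, D.diff (W j) (W j) x = 0) ∧
    (h.IsFormallySelfAdjoint μ D χ ↔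
      ∃ (n : ℕ) (W : Fin n → HomDirac.vectorField I K), h.IsStandardFrame W ∧
        ∀ x : G, ∑ j, D.diff (W j) (W j) x = 0) ∧
    (∃ Z : HomDirac.mm I K, (∀ s : K, HomDirac.AdK I K s Z = Z) ∧
      ∀ (n : ℕ) (W : Fin n → HomDirac.vectorField I K), h.IsStandardFrame W →
        ∀ x : G, ∑ j, D.diff (W j) (W j) x = Z) ∧
    (h.IsFormallySelfAdjoint μ D χ ↔
      ∀ Y : Module.Basis (Fin (Module.finrank ℝ (HomDirac.mm I K))) ℝ (HomDirac.mm I K),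
        h.IsOrthonormal Y → h.ikedaSum D Y = 0) ∧
    (h.IsFormallySelfAdjoint μ D χ ↔
      ∃ Y : Module.Basis (Fin (Module.finrank ℝ (HomDirac.mm I K))) ℝ (HomDirac.mm I K),
        h.IsOrthonormal Y ∧ h.ikedaSum D Y = 0) := by
  have hsa := h.isFormallySelfAdjoint_iff μ hK hD hg hJ χ
  have hframe {n : ℕ} {W : Fin n → HomDirac.vectorField I K} (hW : h.IsStandardFrame W) :
      (∀ x : G, ∑ j, D.diff (W j) (W j) x = 0) ↔ h.diffTrace D = 0 := by
    simp only [h.sum_diff_of_isStandardFrame hD hW, forall_const]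
  have hikeda {Y : Module.Basis (Fin (Module.finrank ℝ (HomDirac.mm I K))) ℝ (HomDirac.mm I K)}
      (hY : h.IsOrthonormal Y) : h.ikedaSum D Y = 0 ↔ h.diffTrace D = 0 := by
    rw [h.ikedaSum_eq hD hY, neg_eq_zero]
  obtain ⟨n, W, hW⟩ := h.exists_isStandardFrame
  obtain ⟨Y, hY⟩ := h.isInnerForm.exists_orthonormal_basis
  exact ⟨hsa.trans ⟨fun hZ _ _ hW => (hframe hW).2 hZ, fun hs => (hframe hW).1 (hs n W hW)⟩,
    hsa.trans ⟨fun hZ => ⟨n, W, hW, (hframe hW).2 hZ⟩, fun ⟨_, _, hW, hs⟩ => (hframe hW).1 hs⟩,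
    ⟨h.diffTrace D, h.AdK_diffTrace hD, fun _ _ hW => h.sum_diff_of_isStandardFrame hD hW⟩,
    hsa.trans ⟨fun hZ _ hY => (hikeda hY).2 hZ, fun hs => (hikeda hY).1 (hs Y hY)⟩,
    hsa.trans ⟨fun hZ => ⟨Y, hY, (hikeda hY).2 hZ⟩, fun ⟨_, hY, hs⟩ => (hikeda hY).1 hs⟩⟩
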